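/- Let $Z_1,Z_2,Z_3$ be the left invariant vector fields on $SU(2)$, $(Z_if)(s)=\frac{d}{d\lambda}f(s\,e^{\lambda u_i})|_{\lambda=0}$, generated by $$u_1=\tfrac12\begin{pmatrix}0&i\\ i&0\end{pmatrix},\quad u_2=\tfrac12\begin{pmatrix}0&-1\\1&0\end{pmatrix},\quad u_3=\tfrac12\begin{pmatrix}i&0\\0&-i\end{pmatrix},$$ put $X_\pm=-(Z_2\pm i\,Z_1)$, and let $d\mu$ be the normalized Haar measure on $SU(2)$. For a multi-index $\alpha=(\alpha_1,\alpha_2,\alpha_3)$ let $Z^\alpha=c\,\sqrt{\alpha_1!\,\alpha_2!\,\alpha_3!/|\alpha|!}\;\sum_\sigma\sigma$, where $c>0$ is a fixed constant and $\sigma$ runs over the $|\alpha|!/(\alpha_1!\,\alpha_2!\,\alpha_3!)$ distinct ordered products of $|\alpha|$ operators containing $\alpha_i$ factors $Z_i$ ($i=1,2,3$). Put $D^{q,r,\alpha}=\partial_\tau^q\,\partial_\rho^r\,Z^\alpha$. For $\rho_*>0$ and $t\in[0,1)$ let $$N_t=\{0\le\tau\le t,\ 0\le\rho\le\tfrac{\rho_*}{1+\tau},\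 s\in SU(2)\},\qquad S_0=\{\tau=0,\ 0\le\rho\le\rho_*,\ s\in SU(2)\}.$$ Let $m,p$ be non-negative integers with $p>m+2$. There is a constant $C>0$, depending only on $m$ and $p$, such that the following holds for every $\rho_*>0$. Let $\phi_0,\dots,\phi_4$ be complex-valued functions of $(\tau,\rho,s)$, smooth on $\{|\tau|<1,\ \rho\ge0\}\times SU(2)$ (up to the boundary $\rho=0$), which satisfy there the spin-2 equations in the gauge $\mu\equiv1$, i.e. for $k=0,1,2,3$ $$(1+\tau)\,\partial_\tau\phi_k-\rho\,\partial_\rho\phi_k+X_+\phi_{k+1}+(2-k)\,\phi_k=0,$$ $$(1-\tau)\,\partial_\tau\phi_{k+1}+\rho\,\partial_\rho\phi_{k+1}+X_-\phi_k+(1-k)\,\phi_{k+1}=0.$$ Then for all $t\in[0,1)$ and $k=0,\dots,4$ $$\int_{N_t}\sum_{q+r+|\alpha|\le m}|D^{q,r,\alpha}(\partial_\rho^p\phi_k)|^2\,d\tau\,d\rho\,d\mu\ \le\ C\,\sum_{j=0}^4\int_{S_0}\sum_{q+r+|\alpha|\le m}|D^{q,r,\alpha}(\partial_\rho^p\phi_j)|^2\,d\rho\,d\mu,$$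 where all integrals are finite. In particular the left hand side is bounded uniformly in $t\in[0,1)$, i.e. up to $\tau=1$ (the sets $I^+=\{\tau=1,\rho=0\}$ and $\mathcal J^+=\{\tau=1,\rho>0\}$). -/

import Mathlib

open Set MeasureTheory
open scoped ContDiff

noncomputable section

namespace Spin2

/-- The group `SU(2)`, as a topological subspace of the complex `2 × 2` matrices. -/
abbrev SU2 : Type := Matrix.specialUnitaryGroup (Fin 2) ℂ

instance : IsTopologicalGroup SU2 where
  continuous_inv := by
    refine Continuous.subtype_mk ?_ _
    exact continuous_subtype_val.matrix_conjTranspose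

instance : CompactSpace SU2 := by
  have hclosed : IsClosed {A : Matrix (Fin 2) (Fin 2) ℂ |
      A ∈ Matrix.specialUnitaryGroup (Fin 2) ℂ} := by
    have h : {A : Matrix (Fin 2) (Fin 2) ℂ | A ∈ Matrix.specialUnitaryGroup (Fin 2) ℂ} =
        {A | A * star A = 1} ∩ {A | A.det = 1} := by
      ext A
      simp [Matrix.mem_specialUnitaryGroup_iff, Matrix.mem_unitaryGroup_iff]
    rw [h]
    refine IsClosed.inter (isClosed_eq ?_ continuous_const) (isClosed_eq ?_ continuous_const)
    · exact continuous_id.mul (continuous_id.matrix_conjTranspose)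
    · exact continuous_id.matrix_det
  have hbox : IsCompact (Set.pi univ (fun _ : Fin 2 => Set.pi univ
      (fun _ : Fin 2 => Metric.closedBall (0 : ℂ) 1))) :=
    isCompact_univ_pi fun _ => isCompact_univ_pi fun _ => isCompact_closedBall 0 1
  refine isCompact_iff_compactSpace.mp (hbox.of_isClosed_subset hclosed ?_)
  intro A hA i _ j _
  simpa using entry_norm_bound_of_unitary hA.1 i j

instance : MeasurableSpace SU2 := borel SU2

instance : BorelSpace SU2 := ⟨rfl⟩

/-- The normalized Haar measure on `SU(2)`. -/
def haarSU2 : Measure SU2 := Measure.haarMeasure ⊤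

/-- The basis `u₁, u₂, u₃` of the Lie algebra of `SU(2)` (indexed by `0, 1, 2`), with
`[u_i, u_j] = ε_{ijk} u_k`. -/
def u : Fin 3 → Matrix (Fin 2) (Fin 2) ℂ :=
  ![(1 / 2 : ℂ) • !![0, Complex.I; Complex.I, 0],
    (1 / 2 : ℂ) • !![0, -1; 1, 0],
    (1 / 2 : ℂ) • !![Complex.I, 0; 0, -Complex.I]]

theorem star_u (i : Fin 3) : star (u i) = -u i := by
  fin_cases i <;> ext a b <;> fin_cases a <;> fin_cases b <;>
    simp [u]

theorem adjugate_u (i : Fin 3) :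
    !![0, 1; -1, 0] * (u i).transpose * (!![0, 1; -1, 0] : Matrix (Fin 2) (Fin 2) ℂ)⁻¹ = -u i := by
  have hJ : (!![0, 1; -1, 0] : Matrix (Fin 2) (Fin 2) ℂ)⁻¹ = !![0, -1; 1, 0] := by
    apply Matrix.inv_eq_right_inv
    ext a b
    fin_cases a <;> fin_cases b <;> simp [Matrix.mul_apply, Fin.sum_univ_two]
  rw [hJ]
  fin_cases i <;> ext a b <;> fin_cases a <;> fin_cases b <;>
    simp [u, Matrix.mul_apply, Fin.sum_univ_two, Matrix.vecMul, dotProduct]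

theorem exp_u_mem (i : Fin 3) (l : ℝ) :
    NormedSpace.exp (l • u i) ∈ Matrix.specialUnitaryGroup (Fin 2) ℂ := by
  have hinv : NormedSpace.exp (l • u i) * NormedSpace.exp (-(l • u i)) = 1 := by
    rw [← Matrix.exp_add_of_commute _ _ (Commute.refl (l • u i)).neg_right, add_neg_cancel,
      NormedSpace.exp_zero]
  refine Matrix.mem_specialUnitaryGroup_iff.mpr ⟨?_, ?_⟩
  · rw [Matrix.mem_unitaryGroup_iff, Matrix.star_eq_conjTranspose, ← Matrix.exp_conjTranspose,
      ← Matrix.star_eq_conjTranspose, star_smul, star_u, star_trivial, smul_neg]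
    exact hinv
  · have hJu : IsUnit (!![0, 1; -1, 0] : Matrix (Fin 2) (Fin 2) ℂ) := by
      rw [Matrix.isUnit_iff_isUnit_det]
      simp [Matrix.det_fin_two]
    have h1 := Matrix.exp_conj !![0, 1; -1, 0] (l • u i).transpose hJu
    rw [Matrix.exp_transpose, Matrix.transpose_smul, Matrix.mul_smul, Matrix.smul_mul,
      adjugate_u, smul_neg] at h1
    rw [h1] at hinv
    have hJ : (!![0, 1; -1, 0] : Matrix (Fin 2) (Fin 2) ℂ)⁻¹ = !![0, -1; 1, 0] := by
      apply Matrix.inv_eq_right_inv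
      ext a b
      fin_cases a <;> fin_cases b <;> simp [Matrix.mul_apply, Fin.sum_univ_two]
    have h3 := congrFun (congrFun hinv 0) 0
    rw [hJ] at h3
    simp [Matrix.mul_apply, Fin.sum_univ_two, Matrix.vecMul, dotProduct] at h3
    rw [Matrix.det_fin_two]
    linear_combination h3

/-- The one-parameter subgroup `λ ↦ exp (λ u_i)` of `SU(2)`. -/
def expU (i : Fin 3) (l : ℝ) : SU2 := ⟨NormedSpace.exp (l • u i), exp_u_mem i l⟩

/-- Complex functions of `(τ, ρ, s)`. Only their values at `|τ| < 1`, `0 ≤ ρ`, `s ∈ SU(2)` matter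
below. -/
abbrev Fld : Type := ℝ → ℝ → SU2 → ℂ

/-- `f` is smooth on `{|τ| < 1, ρ ≥ 0} × SU(2)`, including the boundary `ρ = 0`: it is the
restriction of a function of `(τ, ρ, matrix)` that is smooth for the matrices in a neighbourhood of
the embedded submanifold `SU(2)`. -/
def SmoothFld (f : Fld) : Prop :=
  ∃ (U : Set (Fin 2 → Fin 2 → ℂ)) (F : ℝ × ℝ × (Fin 2 → Fin 2 → ℂ) → ℂ),
    IsOpen U ∧ (∀ s : SU2, (fun i j => s.1 i j) ∈ U) ∧
    ContDiffOn ℝ ∞ F (Ioo (-1) 1 ×ˢ Ici 0 ×ˢ U) ∧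
    ∀ τ ∈ Ioo (-1 : ℝ) 1, ∀ ρ ∈ Ici (0 : ℝ), ∀ s : SU2,
      f τ ρ s = F (τ, ρ, fun i j => s.1 i j)

/-- `∂_τ`. -/
def dτ (f : Fld) : Fld := fun τ ρ s => deriv (fun x => f x ρ s) τ

/-- `∂_ρ` on `ρ ≥ 0` (one-sided at `ρ = 0`). -/
def dρ (f : Fld) : Fld := fun τ ρ s => derivWithin (fun x => f τ x s) (Ici 0) ρ

/-- The left invariant vector field `Z_i` generated by `u_i`. -/
def Z (i : Fin 3) (f : Fld) : Fld := fun τ ρ s => deriv (fun l : ℝ => f τ ρ (s * expU i l)) 0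

/-- `X_+ = -(Z₂ + i Z₁)`. -/
def Xplus (f : Fld) : Fld := fun τ ρ s => -(Z 1 f τ ρ s + Complex.I * Z 0 f τ ρ s)

/-- `X_- = -(Z₂ - i Z₁)`. -/
def Xminus (f : Fld) : Fld := fun τ ρ s => -(Z 1 f τ ρ s - Complex.I * Z 0 f τ ρ s)

/-- `φ₀, …, φ₄` form a smooth solution on `{|τ| < 1, ρ ≥ 0} × SU(2)` of the spin-2 equations in the
gauge `μ ≡ 1`. -/
structure IsSpin2Solution (φ : Fin 5 → Fld) : Prop where
  smooth : ∀ k, SmoothFld (φ k)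
  eqA : ∀ k : Fin 4, ∀ τ ∈ Ioo (-1 : ℝ) 1, ∀ ρ ∈ Ici (0 : ℝ), ∀ s : SU2,
    (1 + τ) * dτ (φ k.castSucc) τ ρ s - ρ * dρ (φ k.castSucc) τ ρ s
      + Xplus (φ k.succ) τ ρ s + (2 - (k : ℕ)) * φ k.castSucc τ ρ s = 0
  eqB : ∀ k : Fin 4, ∀ τ ∈ Ioo (-1 : ℝ) 1, ∀ ρ ∈ Ici (0 : ℝ), ∀ s : SU2,
    (1 - τ) * dτ (φ k.succ) τ ρ s + ρ * dρ (φ k.succ) τ ρ s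
      + Xminus (φ k.castSucc) τ ρ s + (1 - (k : ℕ)) * φ k.succ τ ρ s = 0

/-- The product `Z_{i₁} ⋯ Z_{i_n}` for a word `i₁ … i_n`. -/
def Zword (w : List (Fin 3)) (f : Fld) : Fld := w.foldr Z f

/-- The words of length `|α|` in which each letter `i` occurs exactly `α i` times. -/
def words (α : Fin 3 → ℕ) : Finset (Fin (∑ i, α i) → Fin 3) :=
  {w | ∀ i, (Finset.univ.filter fun j => w j = i).card = α i}

/-- The operator `Z^α = c √(α! / |α|!) ∑ σ`, the sum running over all distinct products `σ` of
`α i` factors `Z_i`, `i = 1, 2, 3`. -/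
def Zα (c : ℝ) (α : Fin 3 → ℕ) (f : Fld) : Fld := fun τ ρ s =>
  ((c * √((∏ i, (α i).factorial : ℕ) / ((∑ i, α i).factorial : ℕ) : ℝ) : ℝ) : ℂ) *
    ∑ w ∈ words α, Zword (List.ofFn w) f τ ρ s

/-- `D^{q,r,α} = ∂_τ^q ∂_ρ^r Z^α`. -/
def D (c : ℝ) (q r : ℕ) (α : Fin 3 → ℕ) (f : Fld) : Fld := dτ^[q] (dρ^[r] (Zα c α f))

/-- The triples `(q, r, α)` with `q + r + |α| ≤ m`. -/
def indices (m : ℕ) : Finset (ℕ × ℕ × (Fin 3 → ℕ)) :=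
  (Finset.range (m + 1) ×ˢ Finset.range (m + 1) ×ˢ
    Fintype.piFinset fun _ => Finset.range (m + 1)).filter
    fun x => x.1 + x.2.1 + ∑ i, x.2.2 i ≤ m

/-- `∑_{q + r + |α| ≤ m} |D^{q,r,α} f|²`. -/
def density (c : ℝ) (m : ℕ) (f : Fld) (τ ρ : ℝ) (s : SU2) : ℝ :=
  ∑ x ∈ indices m, ‖D c x.1 x.2.1 x.2.2 f τ ρ s‖ ^ 2

/-- `N_t = {0 ≤ τ ≤ t, 0 ≤ ρ ≤ ρ_* / (1 + τ)} × SU(2)`. -/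
def N (ρs t : ℝ) : Set (ℝ × ℝ × SU2) :=
  {x | 0 ≤ x.1 ∧ x.1 ≤ t ∧ 0 ≤ x.2.1 ∧ x.2.1 ≤ ρs / (1 + x.1)}

/-- `S_t`, in the coordinates `(ρ, s)` of the slice `τ = t`. -/
def S (ρs t : ℝ) : Set (ℝ × SU2) := {y | 0 ≤ y.1 ∧ y.1 ≤ ρs / (1 + t)}

end Spin2

end

/-! Each pair of consecutive equations is a symmetric hyperbolic system for `g` = φ_k, `h` = φ_{k+1}
with zeroth order coefficients a = 2 - k, b = 1 - k. The obstacle is the factor 1 - τ in front of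
∂_τ h: it degenerates at τ = 1, so the natural energy loses `h` there. The cure is differentiation.
Since ∂_τ and ∂_ρ have simple commutators with the transport operators, ∂_τ^q ∂_ρ^r turns (a, b)
into (a + q - r, b - q + r) (`IsSpinPair.mixed`). After p > m + 2 extra ρ-derivatives b ≥ 1 for
every pair and every q ≤ m, and the zeroth order term of `h` becomes a damping that controls `h` in
the spacetime integral without any degenerate weight.

The Z_i do not commute with X_±. However, ∑ |Z_w f|² over all words w of a fixed length is an
invariant form, because the structure constants are antisymmetric; hence X_± obey a Leibniz rule for
it (`map_wordForm`). Viewed as a bilinear form in f and its conjugate, it makes the coupling terms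
exact derivatives X_±(…) (`IsPair.energy`), which integrate to zero against Haar measure
(`integral_ζ`). No lower order terms in Z arise.

In the coordinate σ = (1 + τ)ρ the region is 0 ≤ σ ≤ ρ_*, and (1 + τ)∂_τ - ρ∂_ρ is (1 + τ) d/dτ at
fixed σ. If G, H are the slice integrals of the forms of `g`, `h` against dσ dμ, then E = G + (1 -
τ)/(1 + τ) H satisfies E' ≤ (2|a|G - 2bH)/(1 + τ). The discarded term is the outflow of `h` through
σ = ρ_*, which has a sign; ρ = 0 contributes nothing because the flux carries a factor ρ. Grönwall's
argument bounds G pointwise and ∫ H dτ, uniformly up to τ = 1 (`integral_le_of_energy_inequality`).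

Finally, the symmetrized Z^α are compared with words: reordering a word costs only shorter words
(`wordEnd_mem_span_symEnd`), so both densities are comparable pointwise, with universal constants.
-/

noncomputable section

namespace Spin2

/-! ### Smooth extensions to the ambient space and commutators of the vector fields -/

/-- The real vector space of complex `2 × 2` arrays, in which `SU(2)` is embedded. -/
abbrev Mat : Type := Fin 2 → Fin 2 → ℂ

/-- The ambient space of the variables `(τ, ρ, matrix)`. -/
abbrev Amb : Type := ℝ × ℝ × Mat

/-- The embedding of `SU(2)` into the arrays. -/
def emb (s : SU2) : Mat := fun i j => s.1 i j

/-- The domain of an ambient extension. -/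
def tube (U : Set Mat) : Set Amb := Ioo (-1) 1 ×ˢ Ici 0 ×ˢ U

theorem uniqueDiffOn_tube {U : Set Mat} (hU : IsOpen U) : UniqueDiffOn ℝ (tube U) :=
  isOpen_Ioo.uniqueDiffOn.prod ((uniqueDiffOn_Ici 0).prod hU.uniqueDiffOn)

theorem tube_subset_closure_interior {U : Set Mat} (hU : IsOpen U) :
    tube U ⊆ closure (interior (tube U)) := by
  simp only [tube, interior_prod_eq, closure_prod_eq, interior_Ioo, interior_Ici, hU.interior_eq,
    closure_Ioi]
  exact prod_mono subset_closure (prod_mono subset_rfl subset_closure)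

/-- Right multiplication by a matrix. -/
def mulRightL (B : Matrix (Fin 2) (Fin 2) ℂ) : Mat →L[ℝ] Mat :=
  LinearMap.toContinuousLinearMap
    { toFun := fun A i j => ∑ k, A i k * B k j
      map_add' := fun A A' => by
        ext i j
        simp [add_mul, Finset.sum_add_distrib]
      map_smul' := fun c A => by
        ext i j
        simp [mul_assoc] }

theorem mulRightL_apply (B : Matrix (Fin 2) (Fin 2) ℂ) (A : Mat) (i j : Fin 2) :
    mulRightL B A i j = ∑ k, A i k * B k j := rfl

/-- The linear vector field on the ambient space that extends `Z i`. -/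
def genL (i : Fin 3) : Amb →L[ℝ] Amb :=
  (ContinuousLinearMap.inr ℝ ℝ (ℝ × Mat)).comp ((ContinuousLinearMap.inr ℝ ℝ Mat).comp
    ((mulRightL (u i)).comp ((ContinuousLinearMap.snd ℝ ℝ Mat).comp
      (ContinuousLinearMap.snd ℝ ℝ (ℝ × Mat)))))

theorem genL_apply (i : Fin 3) (x : Amb) : genL i x = (0, 0, mulRightL (u i) x.2.2) := rfl

/-- The derivative of `F` within `Ω` along the affine vector field `v + B`. -/
def along (Ω : Set Amb) (v : Amb) (B : Amb →L[ℝ] Amb) (F : Amb → ℂ) (x : Amb) : ℂ :=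
  fderivWithin ℝ F Ω x (v + B x)

theorem contDiffOn_along {Ω : Set Amb} (hΩ : UniqueDiffOn ℝ Ω) (v : Amb) (B : Amb →L[ℝ] Amb)
    {F : Amb → ℂ} (hF : ContDiffOn ℝ ∞ F Ω) : ContDiffOn ℝ ∞ (along Ω v B F) Ω :=
  (hF.fderivWithin hΩ (by simp)).clm_apply (contDiff_const.add B.contDiff).contDiffOn

/-- The second derivatives of `F` cancel by symmetry, and only the bracket of the affine fields
survives. The hypothesis that `x` lies in the closure of the interior gives the symmetry also at
boundary points ρ = 0. -/
theorem along_along_sub {Ω : Set Amb} (hΩ : UniqueDiffOn ℝ Ω) {v w : Amb} {B C : Amb →L[ℝ] Amb}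
    {F : Amb → ℂ} (hF : ContDiffOn ℝ ∞ F Ω) {x : Amb} (hx : x ∈ Ω)
    (hx' : x ∈ closure (interior Ω)) :
    along Ω v B (along Ω w C F) x - along Ω w C (along Ω v B F) x =
      fderivWithin ℝ F Ω x (C (v + B x) - B (w + C x)) := by
  have key : ∀ (v w : Amb) (B C : Amb →L[ℝ] Amb), along Ω v B (along Ω w C F) x =
      fderivWithin ℝ F Ω x (C (v + B x)) +
        fderivWithin ℝ (fderivWithin ℝ F Ω) Ω x (v + B x) (w + C x) := by
    intro v w B C
    have h1 : DifferentiableWithinAt ℝ (fderivWithin ℝ F Ω) Ω x :=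
      ((hF.fderivWithin (m := ∞) hΩ (by simp)).differentiableOn (by simp)) x hx
    have h2 : HasFDerivWithinAt (fun y : Amb => w + C y) C Ω x :=
      C.hasFDerivWithinAt.const_add w
    have h3 := (h1.hasFDerivWithinAt.clm_apply h2).fderivWithin (hΩ x hx)
    unfold along
    rw [h3]
    rfl
  have hsymm : IsSymmSndFDerivWithinAt ℝ F Ω x :=
    (hF x hx).isSymmSndFDerivWithinAt
      (by simpa using WithTop.coe_le_coe.2 (le_top : (2 : ℕ∞) ≤ ⊤)) hΩ hx' hx
  rw [key v w B C, key w v C B, hsymm.eq (v + B x) (w + C x), map_sub]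
  ring

theorem hasDerivWithinAt_comp {Ω : Set Amb} {F : Amb → ℂ} (hF : ContDiffOn ℝ ∞ F Ω)
    {γ : ℝ → Amb} {v : Amb} {T : Set ℝ} {t : ℝ} (hγ : HasDerivWithinAt γ v T t)
    (hT : MapsTo γ T Ω) (ht : t ∈ T) :
    HasDerivWithinAt (fun x => F (γ x)) (fderivWithin ℝ F Ω (γ t) v) T t :=
  (((hF.differentiableOn (by simp)) (γ t) (hT ht)).hasFDerivWithinAt).comp_hasDerivWithinAt t hγ hT

theorem hasDerivAt_emb_mul_expU (i : Fin 3) (s : SU2) (l : ℝ) :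
    HasDerivAt (fun l : ℝ => emb (s * expU i l)) (mulRightL (u i) (emb (s * expU i l))) l := by
  -- The derivative of the exponential needs a submultiplicative norm. It is chosen locally, and the
  -- result is transferred entry by entry.
  let _ : NormedRing (Matrix (Fin 2) (Fin 2) ℂ) := Matrix.linftyOpNormedRing
  let _ : NormedAlgebra ℝ (Matrix (Fin 2) (Fin 2) ℂ) := Matrix.linftyOpNormedAlgebra
  have h : HasDerivAt (fun l : ℝ => NormedSpace.exp (l • u i))
      (NormedSpace.exp (l • u i) * u i) l := hasDerivAt_exp_smul_const (u i) l
  have h2 := h.const_mul (s.1)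
  refine hasDerivAt_pi.2 fun a => hasDerivAt_pi.2 fun b => ?_
  let L : Matrix (Fin 2) (Fin 2) ℂ →L[ℝ] ℂ := LinearMap.toContinuousLinearMap
    { toFun := fun A => A a b, map_add' := fun _ _ => rfl, map_smul' := fun _ _ => rfl }
  have h3 := L.hasFDerivAt.comp_hasDerivAt l h2
  have e : (mulRightL (u i) (emb (s * expU i l))) a b =
      L (s.1 * (NormedSpace.exp (l • u i) * u i)) := by
    rw [← mul_assoc]
    rfl
  rw [e]
  exact h3

theorem expU_zero (i : Fin 3) : expU i 0 = 1 := by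
  apply Subtype.ext
  simp [expU]

theorem continuous_emb : Continuous emb := by
  refine continuous_pi fun i => continuous_pi fun j => ?_
  exact continuous_subtype_val.matrix_elem i j

/-- `F` is a smooth ambient extension of the field `f`. -/
structure IsExt (U : Set Mat) (F : Amb → ℂ) (f : Fld) : Prop where
  isOpen : IsOpen U
  emb_mem : ∀ s : SU2, emb s ∈ U
  contDiffOn : ContDiffOn ℝ ∞ F (tube U)
  eq : ∀ τ ∈ Ioo (-1 : ℝ) 1, ∀ ρ ∈ Ici (0 : ℝ), ∀ s : SU2, f τ ρ s = F (τ, ρ, emb s)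

theorem smoothFld_iff {f : Fld} : SmoothFld f ↔ ∃ U F, IsExt U F f :=
  ⟨fun ⟨U, F, h1, h2, h3, h4⟩ => ⟨U, F, h1, h2, h3, h4⟩,
    fun ⟨U, F, h⟩ => ⟨U, F, h.1, h.2, h.3, h.4⟩⟩

theorem SmoothFld.of_eq {f g : Fld} (hf : SmoothFld f)
    (h : ∀ τ ∈ Ioo (-1 : ℝ) 1, ∀ ρ ∈ Ici (0 : ℝ), ∀ s : SU2, g τ ρ s = f τ ρ s) :
    SmoothFld g := by
  obtain ⟨U, F, h1, h2, h3, h4⟩ := hf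
  exact ⟨U, F, h1, h2, h3, fun τ hτ ρ hρ s => (h τ hτ ρ hρ s).trans (h4 τ hτ ρ hρ s)⟩

theorem mem_tube {U : Set Mat} {τ ρ : ℝ} {A : Mat} (hτ : τ ∈ Ioo (-1 : ℝ) 1)
    (hρ : ρ ∈ Ici (0 : ℝ)) (hA : A ∈ U) : ((τ, ρ, A) : Amb) ∈ tube U := ⟨hτ, hρ, hA⟩

theorem IsExt.hasDerivAt_τ {U : Set Mat} {F : Amb → ℂ} {f : Fld} (h : IsExt U F f) {τ ρ : ℝ}
    (hτ : τ ∈ Ioo (-1 : ℝ) 1) (hρ : ρ ∈ Ici (0 : ℝ)) (s : SU2) :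
    HasDerivAt (fun x => f x ρ s) (fderivWithin ℝ F (tube U) (τ, ρ, emb s) (1, 0, 0)) τ := by
  have h1 : HasDerivWithinAt (fun x : ℝ => ((x, ρ, emb s) : Amb)) (1, 0, 0) (Ioo (-1) 1) τ :=
    ((hasDerivAt_id τ).prodMk ((hasDerivAt_const τ ρ).prodMk
      (hasDerivAt_const τ (emb s)))).hasDerivWithinAt
  have h2 := hasDerivWithinAt_comp h.contDiffOn h1
    (fun x hx => mem_tube hx hρ (h.emb_mem s)) hτ
  exact (h2.congr (fun x hx => h.eq x hx ρ hρ s) (h.eq τ hτ ρ hρ s)).hasDerivAt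
    (isOpen_Ioo.mem_nhds hτ)

theorem IsExt.hasDerivWithinAt_ρ {U : Set Mat} {F : Amb → ℂ} {f : Fld} (h : IsExt U F f) {τ ρ : ℝ}
    (hτ : τ ∈ Ioo (-1 : ℝ) 1) (hρ : ρ ∈ Ici (0 : ℝ)) (s : SU2) :
    HasDerivWithinAt (fun x => f τ x s)
      (fderivWithin ℝ F (tube U) (τ, ρ, emb s) (0, 1, 0)) (Ici 0) ρ := by
  have h1 : HasDerivWithinAt (fun x : ℝ => ((τ, x, emb s) : Amb)) (0, 1, 0) (Ici 0) ρ :=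
    ((hasDerivAt_const ρ τ).prodMk ((hasDerivAt_id ρ).prodMk
      (hasDerivAt_const ρ (emb s)))).hasDerivWithinAt
  have h2 := hasDerivWithinAt_comp h.contDiffOn h1
    (fun x hx => mem_tube hτ hx (h.emb_mem s)) hρ
  exact h2.congr (fun x hx => h.eq τ hτ x hx s) (h.eq τ hτ ρ hρ s)

theorem IsExt.hasDerivAt_Z {U : Set Mat} {F : Amb → ℂ} {f : Fld} (h : IsExt U F f) {τ ρ : ℝ}
    (hτ : τ ∈ Ioo (-1 : ℝ) 1) (hρ : ρ ∈ Ici (0 : ℝ)) (s : SU2) (i : Fin 3) (l : ℝ) :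
    HasDerivAt (fun l => f τ ρ (s * expU i l))
      (fderivWithin ℝ F (tube U) (τ, ρ, emb (s * expU i l))
        (genL i (τ, ρ, emb (s * expU i l)))) l := by
  have h1 : HasDerivWithinAt (fun l : ℝ => ((τ, ρ, emb (s * expU i l)) : Amb))
      (genL i (τ, ρ, emb (s * expU i l))) univ l :=
    ((hasDerivAt_const l τ).prodMk ((hasDerivAt_const l ρ).prodMk
      (hasDerivAt_emb_mul_expU i s l))).hasDerivWithinAt
  have h2 := hasDerivWithinAt_comp h.contDiffOn h1
    (fun x _ => mem_tube hτ hρ (h.emb_mem _)) (mem_univ l)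
  exact (h2.congr (fun x _ => h.eq τ hτ ρ hρ _) (h.eq τ hτ ρ hρ _)).hasDerivAt Filter.univ_mem

theorem IsExt.dτ_eq {U : Set Mat} {F : Amb → ℂ} {f : Fld} (h : IsExt U F f) {τ ρ : ℝ}
    (hτ : τ ∈ Ioo (-1 : ℝ) 1) (hρ : ρ ∈ Ici (0 : ℝ)) (s : SU2) :
    dτ f τ ρ s = along (tube U) (1, 0, 0) 0 F (τ, ρ, emb s) := by
  simpa [along, Spin2.dτ] using (h.hasDerivAt_τ hτ hρ s).deriv

theorem IsExt.dρ_eq {U : Set Mat} {F : Amb → ℂ} {f : Fld} (h : IsExt U F f) {τ ρ : ℝ}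
    (hτ : τ ∈ Ioo (-1 : ℝ) 1) (hρ : ρ ∈ Ici (0 : ℝ)) (s : SU2) :
    dρ f τ ρ s = along (tube U) (0, 1, 0) 0 F (τ, ρ, emb s) := by
  simpa [along, Spin2.dρ] using (h.hasDerivWithinAt_ρ hτ hρ s).derivWithin (uniqueDiffOn_Ici 0 ρ hρ)

theorem IsExt.Z_eq {U : Set Mat} {F : Amb → ℂ} {f : Fld} (h : IsExt U F f) {τ ρ : ℝ}
    (hτ : τ ∈ Ioo (-1 : ℝ) 1) (hρ : ρ ∈ Ici (0 : ℝ)) (s : SU2) (i : Fin 3) :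
    Z i f τ ρ s = along (tube U) 0 (genL i) F (τ, ρ, emb s) := by
  simpa [along, expU_zero, Spin2.Z] using (h.hasDerivAt_Z hτ hρ s i 0).deriv

/-- The chain rule along the curves `(1 + τ) ρ = const`. -/
theorem IsExt.hasDerivAt_curve {U : Set Mat} {F : Amb → ℂ} {f : Fld} (h : IsExt U F f) {τ : ℝ}
    (hτ : τ ∈ Ioo (-1 : ℝ) 1) (s : SU2) {σ : ℝ} (hσ : 0 ≤ σ) :
    HasDerivAt (fun x => f x (σ / (1 + x)) s)
      (dτ f τ (σ / (1 + τ)) s - ((σ / (1 + τ) ^ 2 : ℝ) : ℂ) * dρ f τ (σ / (1 + τ)) s) τ := by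
  have hpos : ∀ x ∈ Ioo (-1 : ℝ) 1, 0 < 1 + x := fun x hx => by linarith [hx.1]
  have hmem : ∀ x ∈ Ioo (-1 : ℝ) 1, σ / (1 + x) ∈ Ici (0 : ℝ) := fun x hx =>
    div_nonneg hσ (hpos x hx).le
  have h0 : HasDerivAt (fun x : ℝ => σ / (1 + x)) (-(σ / (1 + τ) ^ 2)) τ := by
    have := (hasDerivAt_const τ σ).div ((hasDerivAt_id τ).const_add 1) (hpos τ hτ).ne'
    refine this.congr_deriv ?_
    simp [neg_div]
  have h1 : HasDerivWithinAt (fun x : ℝ => ((x, σ / (1 + x), emb s) : Amb))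
      (1, -(σ / (1 + τ) ^ 2), 0) (Ioo (-1) 1) τ :=
    ((hasDerivAt_id τ).prodMk (h0.prodMk (hasDerivAt_const τ (emb s)))).hasDerivWithinAt
  have h2 := hasDerivWithinAt_comp h.contDiffOn h1
    (fun x hx => mem_tube hx (hmem x hx) (h.emb_mem s)) hτ
  have h3 := (h2.congr (fun x hx => h.eq x hx _ (hmem x hx) s)
    (h.eq τ hτ _ (hmem τ hτ) s)).hasDerivAt (isOpen_Ioo.mem_nhds hτ)
  refine h3.congr_deriv ?_
  have hv : ((1, -(σ / (1 + τ) ^ 2), 0) : Amb) =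
      (1, 0, 0) - (σ / (1 + τ) ^ 2) • ((0, 1, 0) : Amb) := by simp
  rw [h.dτ_eq hτ (hmem τ hτ) s, h.dρ_eq hτ (hmem τ hτ) s, hv, map_sub, map_smul]
  simp [along]

theorem IsExt.dτ {U : Set Mat} {F : Amb → ℂ} {f : Fld} (h : IsExt U F f) :
    IsExt U (along (tube U) (1, 0, 0) 0 F) (dτ f) :=
  ⟨h.isOpen, h.emb_mem, contDiffOn_along (uniqueDiffOn_tube h.isOpen) _ _ h.contDiffOn,
    fun _ hτ _ hρ s => h.dτ_eq hτ hρ s⟩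

theorem IsExt.dρ {U : Set Mat} {F : Amb → ℂ} {f : Fld} (h : IsExt U F f) :
    IsExt U (along (tube U) (0, 1, 0) 0 F) (dρ f) :=
  ⟨h.isOpen, h.emb_mem, contDiffOn_along (uniqueDiffOn_tube h.isOpen) _ _ h.contDiffOn,
    fun _ hτ _ hρ s => h.dρ_eq hτ hρ s⟩

theorem IsExt.Z {U : Set Mat} {F : Amb → ℂ} {f : Fld} (h : IsExt U F f) (i : Fin 3) :
    IsExt U (along (tube U) 0 (genL i) F) (Z i f) :=
  ⟨h.isOpen, h.emb_mem, contDiffOn_along (uniqueDiffOn_tube h.isOpen) _ _ h.contDiffOn,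
    fun _ hτ _ hρ s => h.Z_eq hτ hρ s i⟩

theorem SmoothFld.dτ {f : Fld} (hf : SmoothFld f) : SmoothFld (dτ f) := by
  obtain ⟨U, F, h⟩ := smoothFld_iff.1 hf
  exact smoothFld_iff.2 ⟨_, _, h.dτ⟩

theorem SmoothFld.dρ {f : Fld} (hf : SmoothFld f) : SmoothFld (dρ f) := by
  obtain ⟨U, F, h⟩ := smoothFld_iff.1 hf
  exact smoothFld_iff.2 ⟨_, _, h.dρ⟩

theorem SmoothFld.Z {f : Fld} (hf : SmoothFld f) (i : Fin 3) : SmoothFld (Z i f) := by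
  obtain ⟨U, F, h⟩ := smoothFld_iff.1 hf
  exact smoothFld_iff.2 ⟨_, _, h.Z i⟩

theorem SmoothFld.hasDerivAt_τ {f : Fld} (hf : SmoothFld f) {τ ρ : ℝ} (hτ : τ ∈ Ioo (-1 : ℝ) 1)
    (hρ : ρ ∈ Ici (0 : ℝ)) (s : SU2) : HasDerivAt (fun x => f x ρ s) (Spin2.dτ f τ ρ s) τ := by
  obtain ⟨U, F, h⟩ := smoothFld_iff.1 hf
  exact (h.hasDerivAt_τ hτ hρ s).differentiableAt.hasDerivAt

theorem SmoothFld.hasDerivWithinAt_ρ {f : Fld} (hf : SmoothFld f) {τ ρ : ℝ}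
    (hτ : τ ∈ Ioo (-1 : ℝ) 1) (hρ : ρ ∈ Ici (0 : ℝ)) (s : SU2) :
    HasDerivWithinAt (fun x => f τ x s) (Spin2.dρ f τ ρ s) (Ici 0) ρ := by
  obtain ⟨U, F, h⟩ := smoothFld_iff.1 hf
  exact (h.hasDerivWithinAt_ρ hτ hρ s).differentiableWithinAt.hasDerivWithinAt

theorem SmoothFld.hasDerivAt_Z {f : Fld} (hf : SmoothFld f) {τ ρ : ℝ} (hτ : τ ∈ Ioo (-1 : ℝ) 1)
    (hρ : ρ ∈ Ici (0 : ℝ)) (s : SU2) (i : Fin 3) (l : ℝ) :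
    HasDerivAt (fun l => f τ ρ (s * expU i l)) (Spin2.Z i f τ ρ (s * expU i l)) l := by
  obtain ⟨U, F, h⟩ := smoothFld_iff.1 hf
  rw [h.Z_eq hτ hρ]
  simpa [along] using h.hasDerivAt_Z hτ hρ s i l

theorem SmoothFld.hasDerivAt_Z_zero {f : Fld} (hf : SmoothFld f) {τ ρ : ℝ}
    (hτ : τ ∈ Ioo (-1 : ℝ) 1) (hρ : ρ ∈ Ici (0 : ℝ)) (s : SU2) (i : Fin 3) :
    HasDerivAt (fun l => f τ ρ (s * expU i l)) (Spin2.Z i f τ ρ s) 0 := by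
  simpa [expU_zero] using hf.hasDerivAt_Z hτ hρ s i 0

theorem SmoothFld.dτ_dρ {f : Fld} (hf : SmoothFld f) {τ ρ : ℝ} (hτ : τ ∈ Ioo (-1 : ℝ) 1)
    (hρ : ρ ∈ Ici (0 : ℝ)) (s : SU2) :
    Spin2.dτ (Spin2.dρ f) τ ρ s = Spin2.dρ (Spin2.dτ f) τ ρ s := by
  obtain ⟨U, F, h⟩ := smoothFld_iff.1 hf
  have hx := mem_tube hτ hρ (h.emb_mem s)
  rw [h.dρ.dτ_eq hτ hρ, h.dτ.dρ_eq hτ hρ, ← sub_eq_zero, along_along_sub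
    (uniqueDiffOn_tube h.isOpen) h.contDiffOn hx (tube_subset_closure_interior h.isOpen hx)]
  simp

theorem SmoothFld.dτ_Z {f : Fld} (hf : SmoothFld f) {τ ρ : ℝ} (hτ : τ ∈ Ioo (-1 : ℝ) 1)
    (hρ : ρ ∈ Ici (0 : ℝ)) (s : SU2) (i : Fin 3) :
    Spin2.dτ (Spin2.Z i f) τ ρ s = Spin2.Z i (Spin2.dτ f) τ ρ s := by
  obtain ⟨U, F, h⟩ := smoothFld_iff.1 hf
  have hx := mem_tube hτ hρ (h.emb_mem s)
  rw [(h.Z i).dτ_eq hτ hρ, h.dτ.Z_eq hτ hρ, ← sub_eq_zero, along_along_sub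
    (uniqueDiffOn_tube h.isOpen) h.contDiffOn hx (tube_subset_closure_interior h.isOpen hx)]
  simp only [genL_apply, zero_add, add_zero, _root_.zero_apply, map_zero, sub_zero]
  exact map_zero _

theorem SmoothFld.dρ_Z {f : Fld} (hf : SmoothFld f) {τ ρ : ℝ} (hτ : τ ∈ Ioo (-1 : ℝ) 1)
    (hρ : ρ ∈ Ici (0 : ℝ)) (s : SU2) (i : Fin 3) :
    Spin2.dρ (Spin2.Z i f) τ ρ s = Spin2.Z i (Spin2.dρ f) τ ρ s := by
  obtain ⟨U, F, h⟩ := smoothFld_iff.1 hf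
  have hx := mem_tube hτ hρ (h.emb_mem s)
  rw [(h.Z i).dρ_eq hτ hρ, h.dρ.Z_eq hτ hρ, ← sub_eq_zero, along_along_sub
    (uniqueDiffOn_tube h.isOpen) h.contDiffOn hx (tube_subset_closure_interior h.isOpen hx)]
  simp only [genL_apply, zero_add, add_zero, _root_.zero_apply, map_zero, sub_zero]
  exact map_zero _

/-- The fields are A ↦ A u_i on matrices, and the bracket of two of them is A ↦ A (u_i u_j - u_j
u_i). -/
theorem SmoothFld.Z_Z_sub {f : Fld} (hf : SmoothFld f) {τ ρ : ℝ} (hτ : τ ∈ Ioo (-1 : ℝ) 1)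
    (hρ : ρ ∈ Ici (0 : ℝ)) (s : SU2) {i j k : Fin 3} (hijk : u i * u j - u j * u i = u k) :
    Spin2.Z i (Spin2.Z j f) τ ρ s - Spin2.Z j (Spin2.Z i f) τ ρ s = Spin2.Z k f τ ρ s := by
  obtain ⟨U, F, h⟩ := smoothFld_iff.1 hf
  have hx := mem_tube hτ hρ (h.emb_mem s)
  rw [(h.Z j).Z_eq hτ hρ, (h.Z i).Z_eq hτ hρ, along_along_sub
    (uniqueDiffOn_tube h.isOpen) h.contDiffOn hx (tube_subset_closure_interior h.isOpen hx),
    h.Z_eq hτ hρ]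
  simp only [along, zero_add, genL_apply, Prod.mk_sub_mk, sub_self]
  congr 3
  ext a b
  rw [← hijk]
  simp only [Pi.sub_apply, mulRightL_apply, Matrix.sub_apply, Matrix.mul_apply, Fin.sum_univ_two]
  ring

theorem SmoothFld.hasDerivAt_curve {f : Fld} (hf : SmoothFld f) {τ : ℝ}
    (hτ : τ ∈ Ioo (-1 : ℝ) 1) (s : SU2) {σ : ℝ} (hσ : 0 ≤ σ) :
    HasDerivAt (fun x => f x (σ / (1 + x)) s)
      (Spin2.dτ f τ (σ / (1 + τ)) s -
        ((σ / (1 + τ) ^ 2 : ℝ) : ℂ) * Spin2.dρ f τ (σ / (1 + τ)) s) τ := by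
  obtain ⟨U, F, h⟩ := smoothFld_iff.1 hf
  exact h.hasDerivAt_curve hτ s hσ

/-- The domain `{|τ| < 1, ρ ≥ 0} × SU(2)`. -/
def dom : Set (ℝ × ℝ × SU2) := Ioo (-1) 1 ×ˢ Ici 0 ×ˢ univ

theorem SmoothFld.continuousOn {f : Fld} (hf : SmoothFld f) :
    ContinuousOn (fun x : ℝ × ℝ × SU2 => f x.1 x.2.1 x.2.2) dom := by
  obtain ⟨U, F, h⟩ := smoothFld_iff.1 hf
  have h1 : ContinuousOn (fun x : ℝ × ℝ × SU2 => F (x.1, x.2.1, emb x.2.2)) dom := by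
    refine h.contDiffOn.continuousOn.comp (Continuous.continuousOn ?_) ?_
    · exact continuous_fst.prodMk ((continuous_fst.comp continuous_snd).prodMk
        (continuous_emb.comp (continuous_snd.comp continuous_snd)))
    · exact fun x hx => mem_tube hx.1 hx.2.1 (h.emb_mem _)
  exact h1.congr fun x hx => h.eq _ hx.1 _ hx.2.1 _

theorem SmoothFld.of_contDiff {F : ℝ × ℝ → ℂ} (hF : ContDiff ℝ ∞ F) :
    SmoothFld (fun τ ρ _ => F (τ, ρ)) :=
  ⟨univ, fun x => F (x.1, x.2.1), isOpen_univ, fun _ => mem_univ _,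
    (hF.comp (contDiff_fst.prodMk (contDiff_fst.comp contDiff_snd))).contDiffOn,
    fun _ _ _ _ _ => rfl⟩

theorem SmoothFld.map₂ {f g : Fld} (hf : SmoothFld f) (hg : SmoothFld g) {H : ℂ × ℂ → ℂ}
    (hH : ContDiff ℝ ∞ H) : SmoothFld (fun τ ρ s => H (f τ ρ s, g τ ρ s)) := by
  obtain ⟨U, F, h⟩ := smoothFld_iff.1 hf
  obtain ⟨V, G, k⟩ := smoothFld_iff.1 hg
  refine ⟨U ∩ V, fun x => H (F x, G x), h.isOpen.inter k.isOpen,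
    fun s => ⟨h.emb_mem s, k.emb_mem s⟩, hH.comp_contDiffOn
      ((h.contDiffOn.mono ?_).prodMk (k.contDiffOn.mono ?_)), ?_⟩
  · exact prod_mono subset_rfl (prod_mono subset_rfl inter_subset_left)
  · exact prod_mono subset_rfl (prod_mono subset_rfl inter_subset_right)
  · intro τ hτ ρ hρ s
    show H _ = H _
    rw [h.eq τ hτ ρ hρ s, k.eq τ hτ ρ hρ s]
    rfl

/-! ### Derivations with SU(2) commutation relations: invariant forms, energy identity, reordering
of words -/

section Algebra

variable {A : Type*} [CommRing A] [Algebra ℂ A]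

/-- The commutation relations of the Lie algebra of `SU(2)`. -/
structure IsSU2Triple (ζ : Fin 3 → Derivation ℂ A A) : Prop where
  comm01 : ∀ f, ζ 0 (ζ 1 f) - ζ 1 (ζ 0 f) = ζ 2 f
  comm12 : ∀ f, ζ 1 (ζ 2 f) - ζ 2 (ζ 1 f) = ζ 0 f
  comm20 : ∀ f, ζ 2 (ζ 0 f) - ζ 0 (ζ 2 f) = ζ 1 f

/-- The bilinear form `∑_{|w| = n} (ζ_w f) (ζ_w g)`, the sum running over all words `w` of
length `n`. -/
def wordForm (ζ : Fin 3 → Derivation ℂ A A) : ℕ → A → A → A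
  | 0, f, g => f * g
  | n + 1, f, g => ∑ j, wordForm ζ n (ζ j f) (ζ j g)

variable {ζ : Fin 3 → Derivation ℂ A A}

theorem wordForm_add_left (n : ℕ) (f f' g : A) :
    wordForm ζ n (f + f') g = wordForm ζ n f g + wordForm ζ n f' g := by
  induction n generalizing f f' g with
  | zero => simp [wordForm, add_mul]
  | succ n ih => simp [wordForm, ih, Finset.sum_add_distrib]

theorem wordForm_comm (n : ℕ) (f g : A) : wordForm ζ n f g = wordForm ζ n g f := by
  induction n generalizing f g with
  | zero => simp [wordForm, mul_comm]
  | succ n ih =>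
    simp only [wordForm]
    exact Finset.sum_congr rfl fun j _ => ih _ _

theorem wordForm_add_right (n : ℕ) (f g g' : A) :
    wordForm ζ n f (g + g') = wordForm ζ n f g + wordForm ζ n f g' := by
  rw [wordForm_comm, wordForm_add_left, wordForm_comm n g, wordForm_comm n g']

theorem wordForm_mul_left {c : A} (hc : ∀ j, ζ j c = 0) (n : ℕ) (f g : A) :
    wordForm ζ n (c * f) g = c * wordForm ζ n f g := by
  induction n generalizing f g with
  | zero => simp [wordForm, mul_assoc]
  | succ n ih => simp [wordForm, ih, hc, Finset.mul_sum]

theorem wordForm_mul_right {c : A} (hc : ∀ j, ζ j c = 0) (n : ℕ) (f g : A) :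
    wordForm ζ n f (c * g) = c * wordForm ζ n f g := by
  rw [wordForm_comm, wordForm_mul_left hc, wordForm_comm]

theorem wordForm_smul_left (c : ℂ) (n : ℕ) (f g : A) :
    wordForm ζ n (c • f) g = c • wordForm ζ n f g := by
  rw [Algebra.smul_def, wordForm_mul_left (by simp), ← Algebra.smul_def]

theorem wordForm_smul_right (c : ℂ) (n : ℕ) (f g : A) :
    wordForm ζ n f (c • g) = c • wordForm ζ n f g := by
  rw [wordForm_comm, wordForm_smul_left, wordForm_comm]

/-- A derivation that commutes with the `ζ_j` satisfies the Leibniz rule for the word form. -/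
theorem map_wordForm_of_comm {δ : Derivation ℂ A A} (hδ : ∀ j f, δ (ζ j f) = ζ j (δ f)) (n : ℕ)
    (f g : A) : δ (wordForm ζ n f g) = wordForm ζ n (δ f) g + wordForm ζ n f (δ g) := by
  induction n generalizing f g with
  | zero => simp [wordForm]; ring
  | succ n ih => simp [wordForm, ih, hδ, Finset.sum_add_distrib]

/-- The word form is invariant: the `ζ_i` satisfy the Leibniz rule for it. -/
theorem map_wordForm (hζ : IsSU2Triple ζ) (i : Fin 3) (n : ℕ) (f g : A) :
    ζ i (wordForm ζ n f g) = wordForm ζ n (ζ i f) g + wordForm ζ n f (ζ i g) := by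
  induction n generalizing i f g with
  | zero => simp [wordForm]; ring
  | succ n ih =>
    -- All products are brought to the orders 01, 12, 20. Moving ζ_i past the summed ζ_j produces
    -- commutators that rotate the index j by an antisymmetric matrix. In the sum over j those in
    -- the first slot cancel those in the second.
    have h01 : ∀ f, ζ 1 (ζ 0 f) = ζ 0 (ζ 1 f) + (-1 : ℂ) • ζ 2 f := fun f => by
      rw [← hζ.comm01]; simp
    have h12 : ∀ f, ζ 2 (ζ 1 f) = ζ 1 (ζ 2 f) + (-1 : ℂ) • ζ 0 f := fun f => by
      rw [← hζ.comm12]; simp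
    have h20 : ∀ f, ζ 0 (ζ 2 f) = ζ 2 (ζ 0 f) + (-1 : ℂ) • ζ 1 f := fun f => by
      rw [← hζ.comm20]; simp
    fin_cases i <;>
      simp only [wordForm, Fin.sum_univ_three, map_add, ih, Fin.zero_eta, Fin.mk_one,
        Fin.reduceFinMk, h01, h12, h20, wordForm_add_left, wordForm_add_right, wordForm_smul_left,
        wordForm_smul_right] <;>
      module

/-- `X_+`. -/
def xPlus (ζ : Fin 3 → Derivation ℂ A A) : Derivation ℂ A A := -(ζ 1 + Complex.I • ζ 0)

/-- `X_-`. -/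
def xMinus (ζ : Fin 3 → Derivation ℂ A A) : Derivation ℂ A A := -(ζ 1 - Complex.I • ζ 0)

theorem xPlus_apply (f : A) : xPlus ζ f = (-1 : ℂ) • ζ 1 f + (-Complex.I) • ζ 0 f := by
  simp [xPlus]; ring

theorem xMinus_apply (f : A) : xMinus ζ f = (-1 : ℂ) • ζ 1 f + Complex.I • ζ 0 f := by
  simp [xMinus]; ring

theorem map_wordForm_combination (hζ : IsSU2Triple ζ) (a b : ℂ) (n : ℕ) (f g : A) :
    a • ζ 1 (wordForm ζ n f g) + b • ζ 0 (wordForm ζ n f g) =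
      wordForm ζ n (a • ζ 1 f + b • ζ 0 f) g + wordForm ζ n f (a • ζ 1 g + b • ζ 0 g) := by
  simp only [map_wordForm hζ, wordForm_add_left, wordForm_add_right, wordForm_smul_left,
    wordForm_smul_right, smul_add]
  ring

theorem xPlus_wordForm (hζ : IsSU2Triple ζ) (n : ℕ) (f g : A) :
    xPlus ζ (wordForm ζ n f g) = wordForm ζ n (xPlus ζ f) g + wordForm ζ n f (xPlus ζ g) := by
  simp only [xPlus_apply, map_wordForm_combination hζ]

theorem xMinus_wordForm (hζ : IsSU2Triple ζ) (n : ℕ) (f g : A) :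
    xMinus ζ (wordForm ζ n f g) = wordForm ζ n (xMinus ζ f) g + wordForm ζ n f (xMinus ζ g) := by
  simp only [xMinus_apply, map_wordForm_combination hζ]

/-- Derivations `∂_τ`, `∂_ρ`, `Z_i` and coordinates `τ`, `ρ` with the usual relations. -/
structure IsCoordSystem (ζ : Fin 3 → Derivation ℂ A A) (δτ δρ : Derivation ℂ A A) (T R : A) :
    Prop where
  triple : IsSU2Triple ζ
  comm : ∀ f, δτ (δρ f) = δρ (δτ f)
  comm_τ : ∀ j f, δτ (ζ j f) = ζ j (δτ f)
  comm_ρ : ∀ j f, δρ (ζ j f) = ζ j (δρ f)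
  τ_T : δτ T = 1
  τ_R : δτ R = 0
  ρ_T : δρ T = 0
  ρ_R : δρ R = 1
  ζ_T : ∀ j, ζ j T = 0
  ζ_R : ∀ j, ζ j R = 0

/-- The two equations of the system that couple a pair of consecutive components `g`, `h`, with
arbitrary zeroth order coefficients. -/
def IsPair (δτ δρ X Y : Derivation ℂ A A) (T R : A) (a b : ℂ) (g h : A) : Prop :=
  (1 + T) * δτ g - R * δρ g + X h + a • g = 0 ∧ (1 - T) * δτ h + R * δρ h + Y g + b • h = 0

variable {δτ δρ X Y : Derivation ℂ A A} {T R : A}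

/-- The commutators of ∂_τ with (1 ± τ)∂_τ are ±∂_τ; this raises the first coefficient and lowers
the second. -/
theorem IsPair.map_τ (hs : IsCoordSystem ζ δτ δρ T R) (hX : ∀ f, δτ (X f) = X (δτ f))
    (hY : ∀ f, δτ (Y f) = Y (δτ f)) {a b : ℂ} {g h : A} (H : IsPair δτ δρ X Y T R a b g h) :
    IsPair δτ δρ X Y T R (a + 1) (b - 1) (δτ g) (δτ h) := by
  have h1 := congrArg δτ H.1
  have h2 := congrArg δτ H.2
  simp only [map_add, map_sub, Derivation.leibniz, Derivation.map_one_eq_zero, hs.τ_T, hs.τ_R, hX,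
    hY, hs.comm, Derivation.map_smul, map_zero, smul_eq_mul] at h1 h2
  refine ⟨?_, ?_⟩
  · rw [add_smul, one_smul]
    linear_combination h1
  · rw [sub_smul, one_smul]
    linear_combination h2

/-- Here the commutators of ∂_ρ with ∓ρ∂_ρ are ∓∂_ρ, so the shift is opposite to that of ∂_τ: each
ρ-derivative increases the damping of `h`. -/
theorem IsPair.map_ρ (hs : IsCoordSystem ζ δτ δρ T R) (hX : ∀ f, δρ (X f) = X (δρ f))
    (hY : ∀ f, δρ (Y f) = Y (δρ f)) {a b : ℂ} {g h : A} (H : IsPair δτ δρ X Y T R a b g h) :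
    IsPair δτ δρ X Y T R (a - 1) (b + 1) (δρ g) (δρ h) := by
  have h1 := congrArg δρ H.1
  have h2 := congrArg δρ H.2
  simp only [map_add, map_sub, Derivation.leibniz, Derivation.map_one_eq_zero, hs.ρ_T, hs.ρ_R, hX,
    hY, ← hs.comm, Derivation.map_smul, map_zero, smul_eq_mul] at h1 h2
  refine ⟨?_, ?_⟩
  · rw [sub_smul, one_smul]
    linear_combination h1
  · rw [add_smul, one_smul]
    linear_combination h2

/-- The energy identity for the word form of a pair `g`, `h` and the conjugate pair `g'`, `h'`. -/
theorem IsPair.energy (hs : IsCoordSystem ζ δτ δρ T R) {a b : ℂ} {g h g' h' : A}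
    (H : IsPair δτ δρ (xPlus ζ) (xMinus ζ) T R a b g h)
    (H' : IsPair δτ δρ (xMinus ζ) (xPlus ζ) T R a b g' h') (n : ℕ) :
    (1 + T) * δτ (wordForm ζ n g' g) - R * δρ (wordForm ζ n g' g)
      + ((1 - T) * δτ (wordForm ζ n h' h) + R * δρ (wordForm ζ n h' h)) =
      -((2 * a) • wordForm ζ n g' g) - (2 * b) • wordForm ζ n h' h
        - xMinus ζ (wordForm ζ n h' g) - xPlus ζ (wordForm ζ n g' h) := by
  have hT : ∀ j, ζ j (1 + T) = 0 := fun j => by simp [hs.ζ_T]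
  have hT' : ∀ j, ζ j (1 + (-1 : ℂ) • T) = 0 := fun j => by simp [hs.ζ_T]
  have hR : ∀ j, ζ j ((-1 : ℂ) • R) = 0 := fun j => by simp [hs.ζ_R]
  -- The equations are solved for their transport terms, with differences written as sums with
  -- scalar -1 so that bilinearity of the form applies directly.
  have e1 : (1 + T) * δτ g + ((-1 : ℂ) • R) * δρ g = (-1 : ℂ) • xPlus ζ h + (-a) • g := by
    simp only [neg_smul, one_smul]
    linear_combination H.1
  have e2 : (1 + (-1 : ℂ) • T) * δτ h + R * δρ h = (-1 : ℂ) • xMinus ζ g + (-b) • h := by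
    simp only [neg_smul, one_smul]
    linear_combination H.2
  have e1' : (1 + T) * δτ g' + ((-1 : ℂ) • R) * δρ g' = (-1 : ℂ) • xMinus ζ h' + (-a) • g' := by
    simp only [neg_smul, one_smul]
    linear_combination H'.1
  have e2' : (1 + (-1 : ℂ) • T) * δτ h' + R * δρ h' = (-1 : ℂ) • xPlus ζ g' + (-b) • h' := by
    simp only [neg_smul, one_smul]
    linear_combination H'.2
  -- Each equation is tested against the conjugate of the component it transports. The four coupling
  -- terms then regroup by the Leibniz rule into X_- of the form of `h'`, `g` and X_+ of the form of
  -- `g'`, `h`.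
  have f1 := congrArg (wordForm ζ n g') e1
  have f2 := congrArg (wordForm ζ n h') e2
  have f1' := congrArg (fun x => wordForm ζ n x g) e1'
  have f2' := congrArg (fun x => wordForm ζ n x h) e2'
  simp only [wordForm_add_left, wordForm_add_right, wordForm_smul_left, wordForm_smul_right,
    wordForm_mul_left hT, wordForm_mul_right hT, wordForm_mul_left hT', wordForm_mul_right hT',
    wordForm_mul_left hR, wordForm_mul_right hR, wordForm_mul_left hs.ζ_R,
    wordForm_mul_right hs.ζ_R] at f1 f2 f1' f2'
  simp only [neg_smul, one_smul] at f1 f2 f1' f2'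
  rw [xMinus_wordForm hs.triple, xPlus_wordForm hs.triple, map_wordForm_of_comm hs.comm_τ,
    map_wordForm_of_comm hs.comm_τ, map_wordForm_of_comm hs.comm_ρ,
    map_wordForm_of_comm hs.comm_ρ, two_mul, two_mul, add_smul, add_smul]
  linear_combination f1' + f2' + f1 + f2

/-- The operator `ζ_w` of a word `w`. -/
def wordEnd (ζ : Fin 3 → Derivation ℂ A A) (w : List (Fin 3)) : Module.End ℂ A :=
  w.foldr (fun i L => (ζ i : A →ₗ[ℂ] A) ∘ₗ L) LinearMap.id

theorem wordEnd_cons (i : Fin 3) (w : List (Fin 3)) (f : A) :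
    wordEnd ζ (i :: w) f = ζ i (wordEnd ζ w f) := rfl

theorem wordEnd_append (w w' : List (Fin 3)) (f : A) :
    wordEnd ζ (w ++ w') f = wordEnd ζ w (wordEnd ζ w' f) := by
  induction w with
  | nil => rfl
  | cons i w ih => rw [List.cons_append, wordEnd_cons, wordEnd_cons, ih]

theorem wordForm_eq_sum (n : ℕ) (f g : A) :
    wordForm ζ n f g =
      ∑ w : Fin n → Fin 3, wordEnd ζ (List.ofFn w) f * wordEnd ζ (List.ofFn w) g := by
  induction n generalizing f g with
  | zero => simp [wordForm, wordEnd]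
  | succ n ih =>
    -- The recursion applies the new derivation first, so its letter stands last in the word.
    rw [← (Fin.snocEquiv fun _ : Fin (n + 1) => Fin 3).sum_comp, Fintype.sum_prod_type]
    simp only [wordForm, ih]
    refine Finset.sum_congr rfl fun j _ => Finset.sum_congr rfl fun w _ => ?_
    simp only [Fin.snocEquiv_apply, List.ofFn_succ', Fin.snoc_castSucc, Fin.snoc_last,
      List.concat_eq_append, wordEnd_append]
    rfl

/-- The symmetrized operator `∑ ζ_w`, the sum running over the distinct words `w` with `α i`
letters `i`. -/
def symEnd (ζ : Fin 3 → Derivation ℂ A A) (α : Fin 3 → ℕ) : Module.End ℂ A :=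
  ∑ w ∈ words α, wordEnd ζ (List.ofFn w)

/-- The span of the operators of the words of length less than `n`. -/
def lowerSpan (ζ : Fin 3 → Derivation ℂ A A) (n : ℕ) : Submodule ℂ (Module.End ℂ A) :=
  Submodule.span ℂ (wordEnd ζ '' {w | w.length < n})

theorem comp_mem_lowerSpan (i : Fin 3) {n : ℕ} {L : Module.End ℂ A} (hL : L ∈ lowerSpan ζ n) :
    (ζ i : A →ₗ[ℂ] A) ∘ₗ L ∈ lowerSpan ζ (n + 1) := by
  induction hL using Submodule.span_induction with
  | mem L hL =>
    obtain ⟨w, hw, rfl⟩ := hL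
    exact Submodule.subset_span ⟨i :: w, by simpa using hw, rfl⟩
  | zero => simp
  | add L L' _ _ h h' => rw [LinearMap.comp_add]; exact add_mem h h'
  | smul c L _ h => rw [LinearMap.comp_smul]; exact Submodule.smul_mem _ c h

theorem wordEnd_mem_lowerSpan {w : List (Fin 3)} {n : ℕ} (h : w.length < n) :
    wordEnd ζ w ∈ lowerSpan ζ n := Submodule.subset_span ⟨w, h, rfl⟩

/-- The commutator of the two leading letters is, up to sign, a single ζ_k or zero, which leaves a
word one letter shorter. -/
theorem wordEnd_swap_sub (hζ : IsSU2Triple ζ) (i j : Fin 3) (w : List (Fin 3)) :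
    wordEnd ζ (i :: j :: w) - wordEnd ζ (j :: i :: w) ∈ lowerSpan ζ (w.length + 2) := by
  have key : ∀ i j k, (∀ f, ζ i (ζ j f) - ζ j (ζ i f) = ζ k f) →
      wordEnd ζ (i :: j :: w) - wordEnd ζ (j :: i :: w) ∈ lowerSpan ζ (w.length + 2) := by
    intro i j k h
    have : wordEnd ζ (i :: j :: w) - wordEnd ζ (j :: i :: w) = wordEnd ζ (k :: w) := by
      ext f
      exact h _
    rw [this]
    exact wordEnd_mem_lowerSpan (by simp)
  have key' : ∀ i j k, (∀ f, ζ i (ζ j f) - ζ j (ζ i f) = ζ k f) →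
      wordEnd ζ (j :: i :: w) - wordEnd ζ (i :: j :: w) ∈ lowerSpan ζ (w.length + 2) := by
    intro i j k h
    rw [← neg_sub]
    exact neg_mem (key i j k h)
  fin_cases i <;> fin_cases j
  · simp
  · exact key _ _ _ hζ.comm01
  · exact key' _ _ _ hζ.comm20
  · exact key' _ _ _ hζ.comm01
  · simp
  · exact key _ _ _ hζ.comm12
  · exact key _ _ _ hζ.comm20
  · exact key' _ _ _ hζ.comm12
  · simp

/-- Permutations are generated by adjacent swaps, and composing with a further ζ_i raises the order
of the error by only one. -/
theorem wordEnd_perm_sub (hζ : IsSU2Triple ζ) {w w' : List (Fin 3)} (h : w.Perm w') :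
    wordEnd ζ w - wordEnd ζ w' ∈ lowerSpan ζ w.length := by
  induction h with
  | nil => simp
  | @cons i w w' h ih =>
    have := comp_mem_lowerSpan i ih
    rwa [LinearMap.comp_sub] at this
  | swap i j w => exact wordEnd_swap_sub hζ j i w
  | @trans w₁ w₂ w₃ h₁ h₂ ih₁ ih₂ =>
    rw [← h₁.length_eq] at ih₂
    simpa using add_mem ih₁ ih₂

/-- The multi-indices `α` with `|α| ≤ n`. -/
def multiIndices (n : ℕ) : Finset (Fin 3 → ℕ) :=
  (Fintype.piFinset fun _ => Finset.range (n + 1)).filter fun α => ∑ i, α i ≤ n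

theorem mem_multiIndices {n : ℕ} {α : Fin 3 → ℕ} : α ∈ multiIndices n ↔ ∑ i, α i ≤ n := by
  simp only [multiIndices, Finset.mem_filter, Fintype.mem_piFinset, Finset.mem_range,
    and_iff_right_iff_imp]
  intro h i
  have := Finset.single_le_sum (f := α) (fun _ _ => Nat.zero_le _) (Finset.mem_univ i)
  omega

theorem count_ofFn {n : ℕ} (w : Fin n → Fin 3) (i : Fin 3) :
    (List.ofFn w).count i = (Finset.univ.filter fun j => w j = i).card := by
  induction n with
  | zero => simp
  | succ n ih =>
    rw [List.ofFn_succ, List.count_cons, ih, Fin.card_filter_univ_succ']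
    simp only [beq_iff_eq]
    ring

theorem exists_words_perm (w : List (Fin 3)) :
    ∃ v ∈ words fun i => w.count i, (List.ofFn v).Perm w := by
  have hlen : ∑ i, w.count i = w.length := by
    have h := List.sum_toFinset_count_eq_length w
    rw [← h]
    exact (Finset.sum_subset (Finset.subset_univ _) fun i _ hi => by
      simpa [List.count_eq_zero] using hi).symm
  -- The index type of `words` has the sum of the counts as its size. This equals the length of `w`
  -- only propositionally, hence the cast.
  have hv : List.ofFn (fun j : Fin (∑ i, w.count i) => w.get (j.cast hlen)) = w := by
    apply List.ext_get
    · simp [hlen]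
    · intro n h1 h2
      simp
  refine ⟨fun j => w.get (j.cast hlen), ?_, ?_⟩
  · simp only [words, Finset.mem_filter, Finset.mem_univ, true_and]
    intro i
    rw [← count_ofFn, hv]
  · rw [hv]

theorem words_perm {α : Fin 3 → ℕ} {v v' : Fin (∑ i, α i) → Fin 3} (hv : v ∈ words α)
    (hv' : v' ∈ words α) : (List.ofFn v).Perm (List.ofFn v') := by
  simp only [words, Finset.mem_filter, Finset.mem_univ, true_and] at hv hv'
  rw [List.perm_iff_count]
  intro i
  rw [count_ofFn, count_ofFn, hv' i, hv i]

/-- Every word operator is a combination of symmetrized operators of at most the same order. -/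
theorem wordEnd_mem_span_symEnd (hζ : IsSU2Triple ζ) (n : ℕ) (w : List (Fin 3))
    (hw : w.length ≤ n) :
    wordEnd ζ w ∈ Submodule.span ℂ (symEnd ζ '' (multiIndices n : Set (Fin 3 → ℕ))) := by
  induction n using Nat.strong_induction_on generalizing w with
  | _ n ih =>
    set W := Submodule.span ℂ (symEnd ζ '' (multiIndices n : Set (Fin 3 → ℕ))) with hW
    -- Shorter words lie in the span by the induction hypothesis, so the argument may proceed modulo
    -- lower order.
    have hlow : lowerSpan ζ w.length ≤ W := by
      refine Submodule.span_le.2 ?_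
      rintro _ ⟨v, hv, rfl⟩
      have hv' : v.length < n := lt_of_lt_of_le hv hw
      refine Submodule.span_mono (Set.image_mono ?_) (ih v.length hv' v le_rfl)
      intro α hα
      simp only [Finset.mem_coe, mem_multiIndices] at hα ⊢
      omega
    obtain ⟨v, hv, hvw⟩ := exists_words_perm w
    have hlen : ∑ i, w.count i = w.length := by simpa using hvw.length_eq
    have h1 : symEnd ζ (fun i => w.count i) ∈ W := by
      refine Submodule.subset_span ⟨_, ?_, rfl⟩
      simp only [Finset.mem_coe, mem_multiIndices]
      omega
    -- Modulo shorter words, every summand of the symmetrized operator equals ζ_w. The sum is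
    -- therefore the number of summands times ζ_w, and this number is nonzero.
    have h2 : symEnd ζ (fun i => w.count i) -
        ((words fun i => w.count i).card : ℂ) • wordEnd ζ w ∈ W := by
      have : symEnd ζ (fun i => w.count i) -
          ((words fun i => w.count i).card : ℂ) • wordEnd ζ w =
          ∑ v' ∈ words fun i => w.count i, (wordEnd ζ (List.ofFn v') - wordEnd ζ w) := by
        rw [Finset.sum_sub_distrib, Finset.sum_const, symEnd, Nat.cast_smul_eq_nsmul]
      rw [this]
      refine sum_mem fun v' hv' => hlow ?_
      have hp := (words_perm hv' hv).trans hvw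
      rw [← hp.length_eq]
      exact wordEnd_perm_sub hζ hp
    have hcard : ((words fun i => w.count i).card : ℂ) ≠ 0 := by
      exact_mod_cast (Finset.card_pos.2 ⟨v, hv⟩).ne'
    have h3 := W.sub_mem h1 h2
    rw [sub_sub_cancel] at h3
    exact (W.smul_mem_iff hcard).1 h3

end Algebra

/-! ### The algebra of smooth functions on the domain and its derivations -/

theorem dτ_congr {f g : Fld}
    (h : ∀ τ ∈ Ioo (-1 : ℝ) 1, ∀ ρ ∈ Ici (0 : ℝ), ∀ s : SU2, f τ ρ s = g τ ρ s) {τ ρ : ℝ}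
    (hτ : τ ∈ Ioo (-1 : ℝ) 1) (hρ : ρ ∈ Ici (0 : ℝ)) (s : SU2) : dτ f τ ρ s = dτ g τ ρ s :=
  Filter.EventuallyEq.deriv_eq <| by
    filter_upwards [isOpen_Ioo.mem_nhds hτ] with x hx using h x hx ρ hρ s

theorem dρ_congr {f g : Fld}
    (h : ∀ τ ∈ Ioo (-1 : ℝ) 1, ∀ ρ ∈ Ici (0 : ℝ), ∀ s : SU2, f τ ρ s = g τ ρ s) {τ ρ : ℝ}
    (hτ : τ ∈ Ioo (-1 : ℝ) 1) (hρ : ρ ∈ Ici (0 : ℝ)) (s : SU2) : dρ f τ ρ s = dρ g τ ρ s :=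
  derivWithin_congr (fun x hx => h τ hτ x hx s) (h τ hτ ρ hρ s)

theorem Z_congr {f g : Fld}
    (h : ∀ τ ∈ Ioo (-1 : ℝ) 1, ∀ ρ ∈ Ici (0 : ℝ), ∀ s : SU2, f τ ρ s = g τ ρ s) {τ ρ : ℝ}
    (hτ : τ ∈ Ioo (-1 : ℝ) 1) (hρ : ρ ∈ Ici (0 : ℝ)) (s : SU2) (i : Fin 3) : Z i f τ ρ s = Z i g τ
    ρ s := by
  unfold Z
  congr 1
  ext l
  exact h τ hτ ρ hρ _

open Classical in
/-- Extension by zero of a function on the domain. -/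
def ext (f : dom → ℂ) : Fld := fun τ ρ s => if h : (τ, ρ, s) ∈ dom then f ⟨(τ, ρ, s), h⟩ else 0

theorem ext_of_mem (f : dom → ℂ) {τ ρ : ℝ} (hτ : τ ∈ Ioo (-1 : ℝ) 1) (hρ : ρ ∈ Ici (0 : ℝ))
    (s : SU2) : ext f τ ρ s = f ⟨(τ, ρ, s), hτ, hρ, mem_univ s⟩ :=
  dif_pos _

theorem ext_add (f g : dom → ℂ) (τ ρ : ℝ) (s : SU2) :
    ext (f + g) τ ρ s = ext f τ ρ s + ext g τ ρ s := by
  unfold ext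
  split_ifs <;> simp

theorem ext_mul (f g : dom → ℂ) (τ ρ : ℝ) (s : SU2) :
    ext (f * g) τ ρ s = ext f τ ρ s * ext g τ ρ s := by
  unfold ext
  split_ifs <;> simp

/-- The algebra of the smooth functions on the domain. -/
def smoothAlg : Subalgebra ℂ (dom → ℂ) where
  carrier := {f | SmoothFld (ext f)}
  mul_mem' {f g} hf hg := by
    refine (SmoothFld.map₂ hf hg (H := fun p => p.1 * p.2) (by fun_prop)).of_eq ?_
    intro τ _ ρ _ s
    exact ext_mul f g τ ρ s
  add_mem' {f g} hf hg := by
    refine (SmoothFld.map₂ hf hg (H := fun p => p.1 + p.2) (by fun_prop)).of_eq ?_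
    intro τ _ ρ _ s
    exact ext_add f g τ ρ s
  algebraMap_mem' c := by
    refine (SmoothFld.of_contDiff (F := fun _ => c) contDiff_const).of_eq ?_
    intro τ hτ ρ hρ s
    exact ext_of_mem _ hτ hρ s

/-- The type of the smooth functions on the domain. -/
abbrev SF : Type := smoothAlg

/-- A smooth function as a field, extended by zero. -/
def SF.fld (f : SF) : Fld := ext f.1

theorem SF.smooth (f : SF) : SmoothFld f.fld := f.2

/-- Values off the domain are zero by convention, so every identity in the algebra can be checked
pointwise on the domain. -/
theorem SF.ext_fld {f g : SF}
    (h : ∀ τ ∈ Ioo (-1 : ℝ) 1, ∀ ρ ∈ Ici (0 : ℝ), ∀ s : SU2, f.fld τ ρ s = g.fld τ ρ s) :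
    f = g := by
  apply Subtype.ext
  funext ⟨⟨τ, ρ, s⟩, hτ, hρ, hs⟩
  have := h τ hτ ρ hρ s
  rwa [SF.fld, SF.fld, ext_of_mem _ hτ hρ, ext_of_mem _ hτ hρ] at this

theorem SF.fld_add (f g : SF) (τ ρ : ℝ) (s : SU2) :
    (f + g).fld τ ρ s = f.fld τ ρ s + g.fld τ ρ s := ext_add _ _ _ _ _

theorem SF.fld_mul (f g : SF) (τ ρ : ℝ) (s : SU2) :
    (f * g).fld τ ρ s = f.fld τ ρ s * g.fld τ ρ s := ext_mul _ _ _ _ _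

theorem SF.fld_smul (c : ℂ) (f : SF) (τ ρ : ℝ) (s : SU2) :
    (c • f).fld τ ρ s = c * f.fld τ ρ s := by
  unfold SF.fld Spin2.ext
  split_ifs <;> simp

theorem SF.fld_zero (τ ρ : ℝ) (s : SU2) : (0 : SF).fld τ ρ s = 0 := by
  unfold SF.fld Spin2.ext
  split_ifs <;> simp

theorem SF.fld_one {τ ρ : ℝ} (hτ : τ ∈ Ioo (-1 : ℝ) 1) (hρ : ρ ∈ Ici (0 : ℝ)) (s : SU2) :
    (1 : SF).fld τ ρ s = 1 := ext_of_mem _ hτ hρ s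

theorem SF.fld_neg (f : SF) (τ ρ : ℝ) (s : SU2) : (-f).fld τ ρ s = -f.fld τ ρ s := by
  rw [← neg_one_smul ℂ f, SF.fld_smul, neg_one_mul]

theorem SF.fld_sub (f g : SF) (τ ρ : ℝ) (s : SU2) :
    (f - g).fld τ ρ s = f.fld τ ρ s - g.fld τ ρ s := by
  rw [sub_eq_add_neg, SF.fld_add, SF.fld_neg, sub_eq_add_neg]

theorem SF.fld_sum {ι : Type*} (t : Finset ι) (f : ι → SF) (τ ρ : ℝ) (s : SU2) :
    (∑ i ∈ t, f i).fld τ ρ s = ∑ i ∈ t, (f i).fld τ ρ s := by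
  classical
  induction t using Finset.induction_on with
  | empty => simp [SF.fld_zero]
  | insert i t hi ih => rw [Finset.sum_insert hi, Finset.sum_insert hi, SF.fld_add, ih]

/-- The smooth function defined by a smooth field. -/
def toSF (f : Fld) (hf : SmoothFld f) : SF :=
  ⟨fun x => f x.1.1 x.1.2.1 x.1.2.2, hf.of_eq fun _ hτ _ hρ s => ext_of_mem _ hτ hρ s⟩

theorem toSF_fld {f : Fld} (hf : SmoothFld f) {τ ρ : ℝ} (hτ : τ ∈ Ioo (-1 : ℝ) 1)
    (hρ : ρ ∈ Ici (0 : ℝ)) (s : SU2) : (toSF f hf).fld τ ρ s = f τ ρ s :=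
  ext_of_mem _ hτ hρ s

/-- The derivation of the smooth functions defined by an operator on fields. -/
def mkDeriv (d : Fld → Fld) (hd : ∀ f : Fld, SmoothFld f → SmoothFld (d f))
    (hadd : ∀ (f g : SF), ∀ τ ∈ Ioo (-1 : ℝ) 1, ∀ ρ ∈ Ici (0 : ℝ), ∀ s : SU2,
      d (f + g).fld τ ρ s = d f.fld τ ρ s + d g.fld τ ρ s)
    (hsmul : ∀ (c : ℂ) (f : SF), ∀ τ ∈ Ioo (-1 : ℝ) 1, ∀ ρ ∈ Ici (0 : ℝ), ∀ s : SU2,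
      d (c • f).fld τ ρ s = c * d f.fld τ ρ s)
    (hmul : ∀ (f g : SF), ∀ τ ∈ Ioo (-1 : ℝ) 1, ∀ ρ ∈ Ici (0 : ℝ), ∀ s : SU2,
      d (f * g).fld τ ρ s = f.fld τ ρ s * d g.fld τ ρ s + g.fld τ ρ s * d f.fld τ ρ s) :
    Derivation ℂ SF SF :=
  Derivation.mk'
    { toFun := fun f => toSF (d f.fld) (hd _ f.smooth)
      map_add' := fun f g => SF.ext_fld fun τ hτ ρ hρ s => by
        rw [SF.fld_add, toSF_fld _ hτ hρ, toSF_fld _ hτ hρ, toSF_fld _ hτ hρ, hadd f g τ hτ ρ hρ]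
      map_smul' := fun c f => SF.ext_fld fun τ hτ ρ hρ s => by
        rw [RingHom.id_apply, SF.fld_smul, toSF_fld _ hτ hρ, toSF_fld _ hτ hρ,
          hsmul c f τ hτ ρ hρ] }
    (fun f g => SF.ext_fld fun τ hτ ρ hρ s => by
      rw [smul_eq_mul, smul_eq_mul, SF.fld_add, SF.fld_mul, SF.fld_mul]
      simp only [LinearMap.coe_mk, AddHom.coe_mk]
      rw [toSF_fld _ hτ hρ, toSF_fld _ hτ hρ, toSF_fld _ hτ hρ, hmul f g τ hτ ρ hρ])

/-- `∂_τ` on the smooth functions. -/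
def δτ : Derivation ℂ SF SF :=
  mkDeriv dτ (fun _ hf => hf.dτ)
    (fun f g τ hτ ρ hρ s => by
      have := ((f.smooth.hasDerivAt_τ hτ hρ s).add (g.smooth.hasDerivAt_τ hτ hρ s)).deriv
      rw [← this]
      unfold dτ
      congr 1
      funext x
      exact SF.fld_add f g x ρ s)
    (fun c f τ hτ ρ hρ s => by
      have := ((f.smooth.hasDerivAt_τ hτ hρ s).const_mul c).deriv
      rw [← this]
      unfold dτ
      congr 1
      funext x
      exact SF.fld_smul c f x ρ s)
    (fun f g τ hτ ρ hρ s => by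
      have := ((f.smooth.hasDerivAt_τ hτ hρ s).mul (g.smooth.hasDerivAt_τ hτ hρ s)).deriv
      rw [mul_comm (g.fld τ ρ s), add_comm, ← this]
      unfold dτ
      congr 1
      funext x
      exact SF.fld_mul f g x ρ s)

/-- `∂_ρ` on the smooth functions. -/
def δρ : Derivation ℂ SF SF :=
  mkDeriv dρ (fun _ hf => hf.dρ)
    (fun f g τ hτ ρ hρ s => by
      have := ((f.smooth.hasDerivWithinAt_ρ hτ hρ s).add
        (g.smooth.hasDerivWithinAt_ρ hτ hρ s)).derivWithin (uniqueDiffOn_Ici 0 ρ hρ)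
      rw [← this]
      unfold dρ
      congr 1
      funext x
      exact SF.fld_add f g τ x s)
    (fun c f τ hτ ρ hρ s => by
      have := ((f.smooth.hasDerivWithinAt_ρ hτ hρ s).const_mul c).derivWithin
        (uniqueDiffOn_Ici 0 ρ hρ)
      rw [← this]
      unfold dρ
      congr 1
      funext x
      exact SF.fld_smul c f τ x s)
    (fun f g τ hτ ρ hρ s => by
      have := ((f.smooth.hasDerivWithinAt_ρ hτ hρ s).mul
        (g.smooth.hasDerivWithinAt_ρ hτ hρ s)).derivWithin (uniqueDiffOn_Ici 0 ρ hρ)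
      rw [mul_comm (g.fld τ ρ s), add_comm, ← this]
      unfold dρ
      congr 1
      funext x
      exact SF.fld_mul f g τ x s)

/-- The left invariant vector fields on the smooth functions. -/
def ζ (i : Fin 3) : Derivation ℂ SF SF :=
  mkDeriv (Z i) (fun _ hf => hf.Z i)
    (fun f g τ hτ ρ hρ s => by
      have := ((f.smooth.hasDerivAt_Z_zero hτ hρ s i).add
        (g.smooth.hasDerivAt_Z_zero hτ hρ s i)).deriv
      rw [← this]
      unfold Z
      congr 1
      funext x
      exact SF.fld_add f g τ ρ _)
    (fun c f τ hτ ρ hρ s => by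
      have := ((f.smooth.hasDerivAt_Z_zero hτ hρ s i).const_mul c).deriv
      rw [← this]
      unfold Z
      congr 1
      funext x
      exact SF.fld_smul c f τ ρ _)
    (fun f g τ hτ ρ hρ s => by
      have := ((f.smooth.hasDerivAt_Z_zero hτ hρ s i).mul
        (g.smooth.hasDerivAt_Z_zero hτ hρ s i)).deriv
      simp only [expU_zero, mul_one] at this
      rw [mul_comm (g.fld τ ρ s), add_comm, ← this]
      unfold Z
      congr 1
      funext x
      exact SF.fld_mul f g τ ρ _)

/-- Complex conjugation. -/
def conj (f : SF) : SF :=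
  toSF (fun τ ρ s => star (f.fld τ ρ s))
    (SmoothFld.map₂ f.smooth f.smooth (H := fun p => star p.1)
      (Complex.conjCLE.contDiff.comp contDiff_fst))

theorem δτ_fld (f : SF) {τ ρ : ℝ} (hτ : τ ∈ Ioo (-1 : ℝ) 1) (hρ : ρ ∈ Ici (0 : ℝ)) (s : SU2) :
    (δτ f).fld τ ρ s = dτ f.fld τ ρ s := toSF_fld f.smooth.dτ hτ hρ s

theorem δρ_fld (f : SF) {τ ρ : ℝ} (hτ : τ ∈ Ioo (-1 : ℝ) 1) (hρ : ρ ∈ Ici (0 : ℝ)) (s : SU2) :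
    (δρ f).fld τ ρ s = dρ f.fld τ ρ s := toSF_fld f.smooth.dρ hτ hρ s

theorem ζ_fld (f : SF) {τ ρ : ℝ} (hτ : τ ∈ Ioo (-1 : ℝ) 1) (hρ : ρ ∈ Ici (0 : ℝ)) (s : SU2)
    (i : Fin 3) : (ζ i f).fld τ ρ s = Z i f.fld τ ρ s :=
  toSF_fld (f.smooth.Z i) hτ hρ s

theorem conj_fld (f : SF) {τ ρ : ℝ} (hτ : τ ∈ Ioo (-1 : ℝ) 1) (hρ : ρ ∈ Ici (0 : ℝ)) (s : SU2) :
    (conj f).fld τ ρ s = star (f.fld τ ρ s) := toSF_fld _ hτ hρ s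

theorem conj_δτ (f : SF) : conj (δτ f) = δτ (conj f) := SF.ext_fld fun τ hτ ρ hρ s => by
  rw [conj_fld _ hτ hρ, δτ_fld _ hτ hρ, δτ_fld _ hτ hρ]
  rw [dτ_congr (g := fun τ ρ s => star (f.fld τ ρ s)) (fun τ hτ ρ hρ s => conj_fld f hτ hρ s)
    hτ hρ]
  exact ((f.smooth.hasDerivAt_τ hτ hρ s).star).deriv.symm

theorem conj_δρ (f : SF) : conj (δρ f) = δρ (conj f) := SF.ext_fld fun τ hτ ρ hρ s => by
  rw [conj_fld _ hτ hρ, δρ_fld _ hτ hρ, δρ_fld _ hτ hρ]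
  rw [dρ_congr (g := fun τ ρ s => star (f.fld τ ρ s)) (fun τ hτ ρ hρ s => conj_fld f hτ hρ s)
    hτ hρ]
  exact ((f.smooth.hasDerivWithinAt_ρ hτ hρ s).star).derivWithin
    (uniqueDiffOn_Ici 0 ρ hρ) |>.symm

theorem conj_ζ (i : Fin 3) (f : SF) : conj (ζ i f) = ζ i (conj f) :=
  SF.ext_fld fun τ hτ ρ hρ s => by
    rw [conj_fld _ hτ hρ, ζ_fld _ hτ hρ, ζ_fld _ hτ hρ]
    rw [Z_congr (g := fun τ ρ s => star (f.fld τ ρ s)) (fun τ hτ ρ hρ s => conj_fld f hτ hρ s)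
      hτ hρ]
    exact ((f.smooth.hasDerivAt_Z_zero hτ hρ s i).star).deriv.symm

theorem conj_add (f g : SF) : conj (f + g) = conj f + conj g :=
  SF.ext_fld fun τ hτ ρ hρ s => by
    simp only [conj_fld _ hτ hρ, SF.fld_add, star_add]

theorem conj_mul (f g : SF) : conj (f * g) = conj f * conj g :=
  SF.ext_fld fun τ hτ ρ hρ s => by
    simp only [conj_fld _ hτ hρ, SF.fld_mul, star_mul']

theorem conj_smul (c : ℂ) (f : SF) : conj (c • f) = star c • conj f :=
  SF.ext_fld fun τ hτ ρ hρ s => by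
    simp only [conj_fld _ hτ hρ, SF.fld_smul, star_mul']

theorem conj_zero : conj 0 = 0 :=
  SF.ext_fld fun τ hτ ρ hρ s => by
    simp only [conj_fld _ hτ hρ, SF.fld_zero, star_zero]

theorem conj_one : conj 1 = 1 :=
  SF.ext_fld fun τ hτ ρ hρ s => by
    simp only [conj_fld _ hτ hρ, SF.fld_one hτ hρ, star_one]

theorem conj_wordEnd (w : List (Fin 3)) (f : SF) :
    conj (wordEnd ζ w f) = wordEnd ζ w (conj f) := by
  induction w with
  | nil => rfl
  | cons i w ih => rw [wordEnd_cons, wordEnd_cons, conj_ζ, ih]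

/-- The coordinate `τ`. -/
def coordτ : SF := toSF (fun τ _ _ => (τ : ℂ))
  (SmoothFld.of_contDiff (F := fun p => (p.1 : ℂ)) (Complex.ofRealCLM.contDiff.comp contDiff_fst))

/-- The coordinate `ρ`. -/
def coordρ : SF := toSF (fun _ ρ _ => (ρ : ℂ))
  (SmoothFld.of_contDiff (F := fun p => (p.2 : ℂ)) (Complex.ofRealCLM.contDiff.comp contDiff_snd))

theorem coordτ_fld {τ ρ : ℝ} (hτ : τ ∈ Ioo (-1 : ℝ) 1) (hρ : ρ ∈ Ici (0 : ℝ)) (s : SU2) :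
    coordτ.fld τ ρ s = τ := toSF_fld _ hτ hρ s

theorem coordρ_fld {τ ρ : ℝ} (hτ : τ ∈ Ioo (-1 : ℝ) 1) (hρ : ρ ∈ Ici (0 : ℝ)) (s : SU2) :
    coordρ.fld τ ρ s = ρ := toSF_fld _ hτ hρ s

theorem conj_coordτ : conj coordτ = coordτ := SF.ext_fld fun τ hτ ρ hρ s => by
  simp [conj_fld _ hτ hρ, coordτ_fld hτ hρ]

theorem conj_coordρ : conj coordρ = coordρ := SF.ext_fld fun τ hτ ρ hρ s => by
  simp [conj_fld _ hτ hρ, coordρ_fld hτ hρ]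

theorem u_comm01 : u 0 * u 1 - u 1 * u 0 = u 2 := by
  ext a b
  fin_cases a <;> fin_cases b <;>
    simp [u] <;> ring

theorem u_comm12 : u 1 * u 2 - u 2 * u 1 = u 0 := by
  ext a b
  fin_cases a <;> fin_cases b <;>
    simp [u] <;> ring

theorem u_comm20 : u 2 * u 0 - u 0 * u 2 = u 1 := by
  ext a b
  fin_cases a <;> fin_cases b <;>
    simp [u] <;> first
    | linear_combination (-1 / 2 : ℂ) * Complex.I_sq
    | linear_combination (1 / 2 : ℂ) * Complex.I_sq

theorem ζ_comm {i j k : Fin 3} (h : u i * u j - u j * u i = u k) (f : SF) :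
    ζ i (ζ j f) - ζ j (ζ i f) = ζ k f := SF.ext_fld fun τ hτ ρ hρ s => by
  rw [SF.fld_sub, ζ_fld _ hτ hρ, ζ_fld _ hτ hρ, ζ_fld _ hτ hρ,
    Z_congr (fun _ hτ _ hρ s => ζ_fld f hτ hρ s j) hτ hρ,
    Z_congr (fun _ hτ _ hρ s => ζ_fld f hτ hρ s i) hτ hρ]
  exact f.smooth.Z_Z_sub hτ hρ s h

theorem isCoordSystem : IsCoordSystem ζ δτ δρ coordτ coordρ where
  triple := ⟨ζ_comm u_comm01, ζ_comm u_comm12, ζ_comm u_comm20⟩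
  comm f := SF.ext_fld fun τ hτ ρ hρ s => by
    rw [δτ_fld _ hτ hρ, δρ_fld _ hτ hρ, dτ_congr (fun _ hτ _ hρ s => δρ_fld f hτ hρ s) hτ hρ,
      dρ_congr (fun _ hτ _ hρ s => δτ_fld f hτ hρ s) hτ hρ]
    exact f.smooth.dτ_dρ hτ hρ s
  comm_τ j f := SF.ext_fld fun τ hτ ρ hρ s => by
    rw [δτ_fld _ hτ hρ, ζ_fld _ hτ hρ, dτ_congr (fun _ hτ _ hρ s => ζ_fld f hτ hρ s j) hτ hρ,
      Z_congr (fun _ hτ _ hρ s => δτ_fld f hτ hρ s) hτ hρ]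
    exact f.smooth.dτ_Z hτ hρ s j
  comm_ρ j f := SF.ext_fld fun τ hτ ρ hρ s => by
    rw [δρ_fld _ hτ hρ, ζ_fld _ hτ hρ, dρ_congr (fun _ hτ _ hρ s => ζ_fld f hτ hρ s j) hτ hρ,
      Z_congr (fun _ hτ _ hρ s => δρ_fld f hτ hρ s) hτ hρ]
    exact f.smooth.dρ_Z hτ hρ s j
  τ_T := SF.ext_fld fun τ hτ ρ hρ s => by
    rw [δτ_fld _ hτ hρ, SF.fld_one hτ hρ, dτ_congr (fun _ hτ _ hρ s => coordτ_fld hτ hρ s) hτ hρ]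
    exact (hasDerivAt_id τ).ofReal_comp.deriv
  τ_R := SF.ext_fld fun τ hτ ρ hρ s => by
    rw [δτ_fld _ hτ hρ, SF.fld_zero, dτ_congr (fun _ hτ _ hρ s => coordρ_fld hτ hρ s) hτ hρ]
    exact deriv_const _ _
  ρ_T := SF.ext_fld fun τ hτ ρ hρ s => by
    rw [δρ_fld _ hτ hρ, SF.fld_zero, dρ_congr (fun _ hτ _ hρ s => coordτ_fld hτ hρ s) hτ hρ]
    exact congrFun (derivWithin_const _ _) _
  ρ_R := SF.ext_fld fun τ hτ ρ hρ s => by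
    rw [δρ_fld _ hτ hρ, SF.fld_one hτ hρ, dρ_congr (fun _ hτ _ hρ s => coordρ_fld hτ hρ s) hτ hρ]
    exact (hasDerivAt_id ρ).ofReal_comp.hasDerivWithinAt.derivWithin (uniqueDiffOn_Ici 0 ρ hρ)
  ζ_T j := SF.ext_fld fun τ hτ ρ hρ s => by
    rw [ζ_fld _ hτ hρ, SF.fld_zero, Z_congr (fun _ hτ _ hρ s => coordτ_fld hτ hρ s) hτ hρ]
    exact deriv_const _ _
  ζ_R j := SF.ext_fld fun τ hτ ρ hρ s => by
    rw [ζ_fld _ hτ hρ, SF.fld_zero, Z_congr (fun _ hτ _ hρ s => coordρ_fld hτ hρ s) hτ hρ]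
    exact deriv_const _ _

/-! ### Pointwise comparison of the density with the word energies -/

/-- The field `f` agrees with the smooth function `F` on the domain. -/
def Agree (f : Fld) (F : SF) : Prop :=
  ∀ τ ∈ Ioo (-1 : ℝ) 1, ∀ ρ ∈ Ici (0 : ℝ), ∀ s : SU2, f τ ρ s = F.fld τ ρ s

theorem agree_toSF {f : Fld} (hf : SmoothFld f) : Agree f (toSF f hf) :=
  fun _ hτ _ hρ s => (toSF_fld hf hτ hρ s).symm

theorem Agree.dτ {f : Fld} {F : SF} (h : Agree f F) : Agree (dτ f) (δτ F) :=
  fun _ hτ _ hρ s => (dτ_congr h hτ hρ s).trans (δτ_fld F hτ hρ s).symm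

theorem Agree.dρ {f : Fld} {F : SF} (h : Agree f F) : Agree (dρ f) (δρ F) :=
  fun _ hτ _ hρ s => (dρ_congr h hτ hρ s).trans (δρ_fld F hτ hρ s).symm

theorem Agree.Z {f : Fld} {F : SF} (h : Agree f F) (i : Fin 3) : Agree (Z i f) (ζ i F) :=
  fun _ hτ _ hρ s => (Z_congr h hτ hρ s i).trans (ζ_fld F hτ hρ s i).symm

theorem Agree.dτ_iterate {f : Fld} {F : SF} (h : Agree f F) (q : ℕ) :
    Agree (Spin2.dτ^[q] f) (δτ^[q] F) := by
  induction q with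
  | zero => exact h
  | succ q ih =>
    rw [Function.iterate_succ_apply', Function.iterate_succ_apply']
    exact ih.dτ

theorem Agree.dρ_iterate {f : Fld} {F : SF} (h : Agree f F) (q : ℕ) :
    Agree (Spin2.dρ^[q] f) (δρ^[q] F) := by
  induction q with
  | zero => exact h
  | succ q ih =>
    rw [Function.iterate_succ_apply', Function.iterate_succ_apply']
    exact ih.dρ

theorem Agree.zword {f : Fld} {F : SF} (h : Agree f F) (w : List (Fin 3)) :
    Agree (Zword w f) (wordEnd ζ w F) := by
  induction w with
  | nil => exact h
  | cons i w ih => exact ih.Z i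

/-- The weight `√(α! / |α|!)`. -/
def weight (α : Fin 3 → ℕ) : ℝ :=
  √((∏ i, (α i).factorial : ℕ) / ((∑ i, α i).factorial : ℕ) : ℝ)

theorem weight_pos (α : Fin 3 → ℕ) : 0 < weight α := by
  refine Real.sqrt_pos.2 (div_pos ?_ ?_)
  · exact_mod_cast Finset.prod_pos fun i _ => Nat.factorial_pos _
  · exact_mod_cast Nat.factorial_pos _

theorem Agree.zα {f : Fld} {F : SF} (h : Agree f F) (c : ℝ) (α : Fin 3 → ℕ) :
    Agree (Zα c α f) (((c * weight α : ℝ) : ℂ) • symEnd ζ α F) := by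
  intro τ hτ ρ hρ s
  rw [SF.fld_smul, symEnd, LinearMap.sum_apply, SF.fld_sum]
  simp only [Zα]
  congr 1
  exact Finset.sum_congr rfl fun w _ => h.zword _ τ hτ ρ hρ s

theorem wordEnd_comm {δ : Derivation ℂ SF SF} (hδ : ∀ j f, δ (ζ j f) = ζ j (δ f))
    (w : List (Fin 3)) (f : SF) : δ (wordEnd ζ w f) = wordEnd ζ w (δ f) := by
  induction w with
  | nil => rfl
  | cons i w ih => rw [wordEnd_cons, wordEnd_cons, hδ, ih]

theorem symEnd_comm {δ : Derivation ℂ SF SF} (hδ : ∀ j f, δ (ζ j f) = ζ j (δ f))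
    (α : Fin 3 → ℕ) (f : SF) : δ (symEnd ζ α f) = symEnd ζ α (δ f) := by
  simp only [symEnd, LinearMap.sum_apply, map_sum, wordEnd_comm hδ]

theorem iterate_smul_symEnd {δ : Derivation ℂ SF SF} (hδ : ∀ j f, δ (ζ j f) = ζ j (δ f))
    (q : ℕ) (c : ℂ) (α : Fin 3 → ℕ) (f : SF) :
    δ^[q] (c • symEnd ζ α f) = c • symEnd ζ α (δ^[q] f) := by
  induction q with
  | zero => rfl
  | succ q ih => rw [Function.iterate_succ_apply', Function.iterate_succ_apply', ih,
      Derivation.map_smul, symEnd_comm hδ]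

/-- `∂_τ^q ∂_ρ^r F`. -/
def mixed (q r : ℕ) (F : SF) : SF := δτ^[q] (δρ^[r] F)

theorem mixed_iterate (q r p : ℕ) (F : SF) : mixed q r (δρ^[p] F) = mixed q (r + p) F := by
  rw [mixed, mixed, Function.iterate_add_apply]

/-- Since ∂_τ and ∂_ρ commute with the Z_i, the symmetrized operator can be moved outermost. This
separates the mixed derivatives, to which the pair equations apply, from the words. -/
theorem Agree.D {f : Fld} {F : SF} (h : Agree f F) (c : ℝ) (q r : ℕ) (α : Fin 3 → ℕ) :
    Agree (D c q r α f) (((c * weight α : ℝ) : ℂ) • symEnd ζ α (mixed q r F)) := by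
  have := ((h.zα c α).dρ_iterate r).dτ_iterate q
  rwa [iterate_smul_symEnd isCoordSystem.comm_ρ, iterate_smul_symEnd isCoordSystem.comm_τ] at this

/-- `∑_{|w| = n} |Z_w F|²`, as a smooth function. -/
def wordDensity (n : ℕ) (F : SF) : SF := wordForm ζ n (conj F) F

theorem wordDensity_fld (n : ℕ) (F : SF) {τ ρ : ℝ} (hτ : τ ∈ Ioo (-1 : ℝ) 1)
    (hρ : ρ ∈ Ici (0 : ℝ)) (s : SU2) :
    (wordDensity n F).fld τ ρ s =
      ((∑ w : Fin n → Fin 3, ‖(wordEnd ζ (List.ofFn w) F).fld τ ρ s‖ ^ 2 : ℝ) : ℂ) := by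
  rw [wordDensity, wordForm_eq_sum, SF.fld_sum, Complex.ofReal_sum]
  refine Finset.sum_congr rfl fun w _ => ?_
  rw [SF.fld_mul, ← conj_wordEnd, conj_fld _ hτ hρ, Complex.ofReal_pow]
  exact Complex.conj_mul' _

/-- The real-valued function `∑_{|w| = n} |Z_w F|²`. -/
def wordEnergy (n : ℕ) (F : SF) (τ ρ : ℝ) (s : SU2) : ℝ :=
  ∑ w : Fin n → Fin 3, ‖(wordEnd ζ (List.ofFn w) F).fld τ ρ s‖ ^ 2

theorem wordEnergy_nonneg (n : ℕ) (F : SF) (τ ρ : ℝ) (s : SU2) : 0 ≤ wordEnergy n F τ ρ s :=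
  Finset.sum_nonneg fun _ _ => sq_nonneg _

theorem density_eq {f : Fld} {F : SF} (h : Agree f F) (c : ℝ) (m : ℕ) {τ ρ : ℝ}
    (hτ : τ ∈ Ioo (-1 : ℝ) 1) (hρ : ρ ∈ Ici (0 : ℝ)) (s : SU2) :
    density c m f τ ρ s = c ^ 2 * ∑ x ∈ indices m,
      weight x.2.2 ^ 2 * ‖(symEnd ζ x.2.2 (mixed x.1 x.2.1 F)).fld τ ρ s‖ ^ 2 := by
  rw [density, Finset.mul_sum]
  refine Finset.sum_congr rfl fun x _ => ?_
  rw [h.D c x.1 x.2.1 x.2.2 τ hτ ρ hρ s, SF.fld_smul, norm_mul, Complex.norm_real, mul_pow,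
    Real.norm_eq_abs, sq_abs, mul_pow, mul_assoc]

/-- Cauchy–Schwarz over the words with content α, which are among all words of length |α|. -/
theorem norm_symEnd_sq_le (α : Fin 3 → ℕ) (F : SF) (τ ρ : ℝ) (s : SU2) :
    ‖(symEnd ζ α F).fld τ ρ s‖ ^ 2 ≤
      (words α).card * wordEnergy (∑ i, α i) F τ ρ s := by
  rw [symEnd, LinearMap.sum_apply, SF.fld_sum]
  calc ‖∑ w ∈ words α, (wordEnd ζ (List.ofFn w) F).fld τ ρ s‖ ^ 2
      ≤ (∑ w ∈ words α, ‖(wordEnd ζ (List.ofFn w) F).fld τ ρ s‖) ^ 2 := by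
        gcongr
        exact norm_sum_le _ _
    _ ≤ (words α).card * ∑ w ∈ words α, ‖(wordEnd ζ (List.ofFn w) F).fld τ ρ s‖ ^ 2 :=
        sq_sum_le_card_mul_sum_sq
    _ ≤ _ := by
        gcongr
        exact Finset.sum_le_sum_of_subset_of_nonneg (Finset.subset_univ _)
          fun _ _ _ => sq_nonneg _

/-- Every combination of symmetrized operators is bounded by the symmetrized operators. -/
theorem exists_norm_sq_le_of_mem_span {n : ℕ} {L : Module.End ℂ SF}
    (hL : L ∈ Submodule.span ℂ (symEnd ζ '' (multiIndices n : Set (Fin 3 → ℕ)))) :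
    ∃ K : ℝ, 0 ≤ K ∧ ∀ (F : SF) (τ ρ : ℝ) (s : SU2), ‖(L F).fld τ ρ s‖ ^ 2 ≤
      K * ∑ α ∈ multiIndices n, weight α ^ 2 * ‖(symEnd ζ α F).fld τ ρ s‖ ^ 2 := by
  have hnn : ∀ (F : SF) (τ ρ : ℝ) (s : SU2),
      0 ≤ ∑ α ∈ multiIndices n, weight α ^ 2 * ‖(symEnd ζ α F).fld τ ρ s‖ ^ 2 :=
    fun F τ ρ s => Finset.sum_nonneg fun _ _ => by positivity
  induction hL using Submodule.span_induction with
  | mem L hL =>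
    obtain ⟨α, hα, rfl⟩ := hL
    have hw := weight_pos α
    refine ⟨(weight α ^ 2)⁻¹, by positivity, fun F τ ρ s => ?_⟩
    rw [← div_eq_inv_mul, le_div_iff₀ (by positivity), mul_comm]
    exact Finset.single_le_sum
      (f := fun α => weight α ^ 2 * ‖(symEnd ζ α F).fld τ ρ s‖ ^ 2)
      (fun _ _ => by positivity) (Finset.mem_coe.1 hα)
  | zero =>
    refine ⟨0, le_rfl, fun F τ ρ s => ?_⟩
    rw [LinearMap.zero_apply, SF.fld_zero]
    simp
  | add L L' _ _ h h' =>
    obtain ⟨K, hK, h⟩ := h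
    obtain ⟨K', hK', h'⟩ := h'
    refine ⟨2 * K + 2 * K', by positivity, fun F τ ρ s => ?_⟩
    rw [LinearMap.add_apply, SF.fld_add]
    have h1 := h F τ ρ s
    have h2 := h' F τ ρ s
    have h3 := pow_le_pow_left₀ (norm_nonneg _)
      (norm_add_le ((L F).fld τ ρ s) ((L' F).fld τ ρ s)) 2
    have h4 := sq_nonneg (‖(L F).fld τ ρ s‖ - ‖(L' F).fld τ ρ s‖)
    nlinarith
  | smul c L _ h =>
    obtain ⟨K, hK, h⟩ := h
    refine ⟨‖c‖ ^ 2 * K, by positivity, fun F τ ρ s => ?_⟩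
    rw [LinearMap.smul_apply, SF.fld_smul, norm_mul, mul_pow, mul_assoc]
    exact mul_le_mul_of_nonneg_left (h F τ ρ s) (sq_nonneg _)

/-- The coefficients expressing a word through symmetrized operators are fixed in advance, so `K`
depends neither on the function nor on the point. -/
theorem exists_wordEnergy_le (n : ℕ) :
    ∃ K : ℝ, 0 ≤ K ∧ ∀ (F : SF) (τ ρ : ℝ) (s : SU2), wordEnergy n F τ ρ s ≤
      K * ∑ α ∈ multiIndices n, weight α ^ 2 * ‖(symEnd ζ α F).fld τ ρ s‖ ^ 2 := by
  have h : ∀ w : Fin n → Fin 3, _ := fun w => exists_norm_sq_le_of_mem_span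
    (wordEnd_mem_span_symEnd isCoordSystem.triple n (List.ofFn w) (by simp))
  choose K hK h using h
  refine ⟨∑ w, K w, Finset.sum_nonneg fun w _ => hK w, fun F τ ρ s => ?_⟩
  rw [wordEnergy, Finset.sum_mul]
  exact Finset.sum_le_sum fun w _ => h w F τ ρ s

theorem mem_indices {m q r : ℕ} {α : Fin 3 → ℕ} :
    (q, r, α) ∈ indices m ↔ q + r + ∑ i, α i ≤ m := by
  simp only [indices, Finset.mem_filter, Finset.mem_product, Finset.mem_range,
    Fintype.mem_piFinset, and_iff_right_iff_imp]
  intro h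
  refine ⟨by omega, by omega, fun i => ?_⟩
  have := Finset.single_le_sum (f := α) (fun _ _ => Nat.zero_le _) (Finset.mem_univ i)
  omega

/-- The word energies are bounded by the density. -/
theorem exists_wordEnergy_le_density (m : ℕ) :
    ∃ K : ℝ, 0 ≤ K ∧ ∀ (c : ℝ) (f : Fld) (F : SF), Agree f F → ∀ q r n : ℕ, q + r + n ≤ m →
      ∀ τ ∈ Ioo (-1 : ℝ) 1, ∀ ρ ∈ Ici (0 : ℝ), ∀ s : SU2,
        c ^ 2 * wordEnergy n (mixed q r F) τ ρ s ≤ K * density c m f τ ρ s := by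
  choose K hK h using exists_wordEnergy_le
  refine ⟨∑ n ∈ Finset.range (m + 1), K n, Finset.sum_nonneg fun n _ => hK n, ?_⟩
  intro c f F hfF q r n hm τ hτ ρ hρ s
  have h1 : K n ≤ ∑ n ∈ Finset.range (m + 1), K n :=
    Finset.single_le_sum (fun n _ => hK n) (Finset.mem_range.2 (by omega))
  have h2 : ∑ α ∈ multiIndices n,
      weight α ^ 2 * ‖(symEnd ζ α (mixed q r F)).fld τ ρ s‖ ^ 2 ≤
      ∑ x ∈ indices m,
        weight x.2.2 ^ 2 * ‖(symEnd ζ x.2.2 (mixed x.1 x.2.1 F)).fld τ ρ s‖ ^ 2 := by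
    rw [← Finset.sum_image (f := fun x : ℕ × ℕ × (Fin 3 → ℕ) =>
      weight x.2.2 ^ 2 * ‖(symEnd ζ x.2.2 (mixed x.1 x.2.1 F)).fld τ ρ s‖ ^ 2)
      (g := fun α => (q, r, α)) (s := multiIndices n) (fun α _ β _ h => by simpa using h)]
    refine Finset.sum_le_sum_of_subset_of_nonneg ?_ fun _ _ _ => by positivity
    intro x hx
    obtain ⟨α, hα, rfl⟩ := Finset.mem_image.1 hx
    rw [mem_multiIndices] at hα
    exact mem_indices.2 (by omega)
  rw [density_eq hfF c m hτ hρ s, mul_left_comm]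
  refine mul_le_mul_of_nonneg_left ((h n _ τ ρ s).trans ?_) (sq_nonneg c)
  exact mul_le_mul h1 h2 (Finset.sum_nonneg fun _ _ => by positivity) ((hK n).trans h1)

/-- The density is bounded by the word energies. -/
theorem density_le {f : Fld} {F : SF} (h : Agree f F) (c : ℝ) (m : ℕ) {τ ρ : ℝ}
    (hτ : τ ∈ Ioo (-1 : ℝ) 1) (hρ : ρ ∈ Ici (0 : ℝ)) (s : SU2) :
    density c m f τ ρ s ≤ ∑ x ∈ indices m, (weight x.2.2 ^ 2 * (words x.2.2).card) *
      (c ^ 2 * wordEnergy (∑ i, x.2.2 i) (mixed x.1 x.2.1 F) τ ρ s) := by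
  rw [density_eq h c m hτ hρ s, Finset.mul_sum]
  refine Finset.sum_le_sum fun x _ => ?_
  have := mul_le_mul_of_nonneg_left (norm_symEnd_sq_le x.2.2 (mixed x.1 x.2.1 F) τ ρ s)
    (by positivity : 0 ≤ c ^ 2 * weight x.2.2 ^ 2)
  linarith

/-! ### The spin-2 equations as pairs in the algebra -/

section Pairs

theorem conj_xPlus (f : SF) : conj (xPlus ζ f) = xMinus ζ (conj f) := by
  rw [xPlus_apply, xMinus_apply, conj_add, conj_smul, conj_smul, conj_ζ, conj_ζ]
  simp

theorem conj_xMinus (f : SF) : conj (xMinus ζ f) = xPlus ζ (conj f) := by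
  rw [xPlus_apply, xMinus_apply, conj_add, conj_smul, conj_smul, conj_ζ, conj_ζ]
  simp

theorem conj_sub (f g : SF) : conj (f - g) = conj f - conj g := by
  rw [eq_sub_iff_add_eq, ← conj_add, sub_add_cancel]

/-- A pair of consecutive components, in the algebra of smooth functions. -/
abbrev IsSpinPair (a b : ℝ) (g h : SF) : Prop :=
  IsPair δτ δρ (xPlus ζ) (xMinus ζ) coordτ coordρ (a : ℂ) (b : ℂ) g h

/-- The Z_i, the coordinates and the coefficients are real, so conjugation only exchanges X_+ and
X_-. -/
theorem IsSpinPair.conj {a b : ℝ} {g h : SF} (H : IsSpinPair a b g h) :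
    IsPair δτ δρ (xMinus ζ) (xPlus ζ) coordτ coordρ (a : ℂ) (b : ℂ) (conj g) (conj h) := by
  have h1 := congrArg Spin2.conj H.1
  have h2 := congrArg Spin2.conj H.2
  simp only [conj_add, conj_sub, conj_mul, conj_one, conj_zero, conj_smul, conj_coordτ,
    conj_coordρ, conj_δτ, conj_δρ, conj_xPlus, conj_xMinus, Complex.star_def,
    Complex.conj_ofReal] at h1 h2
  exact ⟨h1, h2⟩

theorem xPlus_comm {δ : Derivation ℂ SF SF} (hδ : ∀ j f, δ (ζ j f) = ζ j (δ f)) (f : SF) :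
    δ (xPlus ζ f) = xPlus ζ (δ f) := by
  simp only [xPlus_apply, map_add, Derivation.map_smul, hδ]

theorem xMinus_comm {δ : Derivation ℂ SF SF} (hδ : ∀ j f, δ (ζ j f) = ζ j (δ f)) (f : SF) :
    δ (xMinus ζ f) = xMinus ζ (δ f) := by
  simp only [xMinus_apply, map_add, Derivation.map_smul, hδ]

/-- This is the source of the damping: a large `r` makes the second coefficient positive, at the
price of a negative first one, which costs only a bounded growth factor. -/
theorem IsSpinPair.mixed {a b : ℝ} {g h : SF} (H : IsSpinPair a b g h) (q r : ℕ) :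
    IsSpinPair (a + q - r) (b - q + r) (mixed q r g) (mixed q r h) := by
  have h1 : IsSpinPair (a - r) (b + r) (δρ^[r] g) (δρ^[r] h) := by
    induction r with
    | zero => simpa using H
    | succ r ih =>
      rw [Function.iterate_succ_apply', Function.iterate_succ_apply']
      have := IsPair.map_ρ isCoordSystem (xPlus_comm isCoordSystem.comm_ρ)
        (xMinus_comm isCoordSystem.comm_ρ) ih
      unfold IsSpinPair
      convert this using 1 <;> push_cast <;> ring
  have h2 : IsSpinPair (a - r + q) (b + r - q) (Spin2.mixed q r g) (Spin2.mixed q r h) := by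
    unfold Spin2.mixed
    induction q with
    | zero => simpa using h1
    | succ q ih =>
      rw [Function.iterate_succ_apply', Function.iterate_succ_apply']
      have := IsPair.map_τ isCoordSystem (xPlus_comm isCoordSystem.comm_τ)
        (xMinus_comm isCoordSystem.comm_τ) ih
      unfold IsSpinPair
      convert this using 1 <;> push_cast <;> ring
  convert h2 using 1 <;> ring

theorem IsSpin2Solution.isSpinPair {φ : Fin 5 → Fld} (hφ : IsSpin2Solution φ) (k : Fin 4) :
    IsSpinPair (2 - (k : ℕ)) (1 - (k : ℕ)) (toSF (φ k.castSucc) (hφ.smooth _))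
      (toSF (φ k.succ) (hφ.smooth _)) := by
  have A1 := agree_toSF (hφ.smooth k.castSucc)
  have A2 := agree_toSF (hφ.smooth k.succ)
  refine ⟨SF.ext_fld fun τ hτ ρ hρ s => ?_, SF.ext_fld fun τ hτ ρ hρ s => ?_⟩
  · have := hφ.eqA k τ hτ ρ hρ s
    simp only [Xplus] at this
    rw [A1.dτ τ hτ ρ hρ, A1.dρ τ hτ ρ hρ, A1 τ hτ ρ hρ, A2.Z 1 τ hτ ρ hρ,
      A2.Z 0 τ hτ ρ hρ] at this
    rw [SF.fld_zero, ← this, xPlus_apply]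
    simp only [SF.fld_add, SF.fld_sub, SF.fld_mul, SF.fld_smul, SF.fld_one hτ hρ,
      coordτ_fld hτ hρ, coordρ_fld hτ hρ]
    push_cast
    ring
  · have := hφ.eqB k τ hτ ρ hρ s
    simp only [Xminus] at this
    rw [A2.dτ τ hτ ρ hρ, A2.dρ τ hτ ρ hρ, A2 τ hτ ρ hρ, A1.Z 1 τ hτ ρ hρ,
      A1.Z 0 τ hτ ρ hρ] at this
    rw [SF.fld_zero, ← this, xMinus_apply]
    simp only [SF.fld_add, SF.fld_sub, SF.fld_mul, SF.fld_smul, SF.fld_one hτ hρ,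
      coordτ_fld hτ hρ, coordρ_fld hτ hρ]
    push_cast
    ring

end Pairs

/-! ### Haar measure, integrals over slices and their derivatives -/

instance : haarSU2.IsHaarMeasure := by unfold haarSU2; infer_instance

instance : IsProbabilityMeasure haarSU2 := ⟨by
  unfold haarSU2
  simpa using Measure.haarMeasure_self (K₀ := (⊤ : TopologicalSpace.PositiveCompacts SU2))⟩

/-- A right translate of the measure is again a left Haar probability measure, hence the same one.
Right invariance is what is needed, since left invariant fields generate right translations. -/
theorem map_mul_right_haarSU2 (g : SU2) : haarSU2.map (· * g) = haarSU2 := by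
  have : IsProbabilityMeasure (haarSU2.map (· * g)) :=
    Measure.isProbabilityMeasure_map (continuous_mul_const g).measurable.aemeasurable
  exact Measure.isHaarMeasure_eq_of_isProbabilityMeasure _ _

theorem integral_mul_right_haarSU2 (f : SU2 → ℂ) (g : SU2) :
    ∫ s, f (s * g) ∂haarSU2 = ∫ s, f s ∂haarSU2 := by
  conv_rhs => rw [← map_mul_right_haarSU2 g]
  exact ((Homeomorph.mulRight g).measurableEmbedding.integral_map f).symm

/-- Differentiation under the integral sign over a compact set. -/
theorem hasDerivAt_setIntegral_of_continuousOn {Y : Type*} [TopologicalSpace Y]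
    [MeasurableSpace Y] [OpensMeasurableSpace Y] {μ : Measure Y} [IsFiniteMeasureOnCompacts μ]
    {K : Set Y} (hK : IsCompact K) (hKm : MeasurableSet K) {I : Set ℝ} (hI : IsOpen I)
    {e e' : ℝ → Y → ℂ} (he : ∀ x ∈ I, ContinuousOn (e x) K)
    (he' : ContinuousOn (fun z : ℝ × Y => e' z.1 z.2) (I ×ˢ K))
    (hd : ∀ x ∈ I, ∀ y ∈ K, HasDerivAt (fun x => e x y) (e' x y) x) {x : ℝ} (hx : x ∈ I) :
    HasDerivAt (fun x => ∫ y in K, e x y ∂μ) (∫ y in K, e' x y ∂μ) x := by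
  obtain ⟨ε, hε, hball⟩ := Metric.nhds_basis_closedBall.mem_iff.1 (hI.mem_nhds hx)
  have hcomp : IsCompact (Metric.closedBall x ε ×ˢ K) := (isCompact_closedBall x ε).prod hK
  obtain ⟨C, hC⟩ := hcomp.exists_bound_of_continuousOn
    (he'.mono (prod_mono hball subset_rfl))
  have : IsFiniteMeasure (μ.restrict K) := ⟨by simpa using hK.measure_lt_top⟩
  have hmem : ∀ᵐ y ∂μ.restrict K, y ∈ K := ae_restrict_mem hKm
  refine (hasDerivAt_integral_of_dominated_loc_of_deriv_le (s := Metric.closedBall x ε)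
    (F := e) (F' := e') (bound := fun _ => C) (Metric.closedBall_mem_nhds x hε) ?_ ?_ ?_ ?_ ?_
    ?_).2
  · filter_upwards [hI.mem_nhds hx] with z hz
    exact (he z hz).aestronglyMeasurable_of_isCompact hK hKm
  · exact (he x hx).integrableOn_compact' hK hKm
  · have : ContinuousOn (e' x) K :=
      he'.comp (f := fun y => (x, y)) (by fun_prop) (fun y hy => ⟨hx, hy⟩)
    exact this.aestronglyMeasurable_of_isCompact hK hKm
  · filter_upwards [hmem] with y hy z hz using hC (z, y) ⟨hz, hy⟩
  · exact integrable_const C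
  · filter_upwards [hmem] with y hy z hz using hd z (hball hz) y hy

theorem SF.continuousOn (F : SF) :
    ContinuousOn (fun x : ℝ × ℝ × SU2 => F.fld x.1 x.2.1 x.2.2) dom := F.smooth.continuousOn

theorem SF.continuous_slice (F : SF) {τ ρ : ℝ} (hτ : τ ∈ Ioo (-1 : ℝ) 1) (hρ : ρ ∈ Ici (0 : ℝ)) :
    Continuous (F.fld τ ρ) := by
  rw [← continuousOn_univ]
  exact F.continuousOn.comp (f := fun s : SU2 => (τ, ρ, s)) (by fun_prop)
    (fun s _ => ⟨hτ, hρ, mem_univ s⟩)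

/-- The integral of a left invariant derivative vanishes. -/
theorem integral_ζ (i : Fin 3) (F : SF) {τ ρ : ℝ} (hτ : τ ∈ Ioo (-1 : ℝ) 1)
    (hρ : ρ ∈ Ici (0 : ℝ)) : ∫ s, (ζ i F).fld τ ρ s ∂haarSU2 = 0 := by
  have hexp : Continuous (expU i) := by
    have h : Continuous fun l : ℝ => NormedSpace.exp (l • u i) := by
      have h := continuous_iff_continuousAt.2 fun l =>
        (hasDerivAt_emb_mul_expU i 1 l).continuousAt
      simp only [one_mul] at h
      exact h
    exact Continuous.subtype_mk h _
  have hc : Continuous fun z : ℝ × SU2 => z.2 * expU i z.1 :=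
    continuous_snd.mul (hexp.comp continuous_fst)
  have h := hasDerivAt_setIntegral_of_continuousOn (μ := haarSU2) (K := univ) (I := univ)
    (e := fun l s => F.fld τ ρ (s * expU i l))
    (e' := fun l s => (ζ i F).fld τ ρ (s * expU i l)) (x := 0)
    isCompact_univ MeasurableSet.univ isOpen_univ
    (fun l _ => ((F.continuous_slice hτ hρ).comp (continuous_mul_const _)).continuousOn)
    ((((ζ i F).continuous_slice hτ hρ).comp hc).continuousOn)
    (fun l _ s _ => by
      rw [ζ_fld F hτ hρ]
      exact F.smooth.hasDerivAt_Z hτ hρ s i l) (mem_univ 0)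
  -- By right invariance the differentiated integral does not depend on the group parameter, so its
  -- derivative at 0 is zero.
  simp only [Measure.restrict_univ, integral_mul_right_haarSU2] at h
  exact (h.unique (hasDerivAt_const 0 _))

/-- The slice `[0, ρs] × SU(2)`. -/
def slab (ρs : ℝ) : Set (ℝ × SU2) := Icc 0 ρs ×ˢ univ

theorem isCompact_slab (ρs : ℝ) : IsCompact (slab ρs) := isCompact_Icc.prod isCompact_univ

theorem measurableSet_slab (ρs : ℝ) : MeasurableSet (slab ρs) :=
  measurableSet_Icc.prod MeasurableSet.univ

/-- The integral over `0 ≤ (1 + τ) ρ ≤ ρs` in the coordinate `(1 + τ) ρ`. -/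
def avg (ρs : ℝ) (F : SF) (τ : ℝ) : ℂ :=
  ∫ y in slab ρs, F.fld τ (y.1 / (1 + τ)) y.2 ∂(volume.prod haarSU2)

theorem div_mem_Ici {τ σ : ℝ} (hτ : τ ∈ Ioo (-1 : ℝ) 1) (hσ : 0 ≤ σ) :
    σ / (1 + τ) ∈ Ici (0 : ℝ) :=
  div_nonneg hσ (by linarith [hτ.1])

theorem SF.continuousOn_curve (F : SF) :
    ContinuousOn (fun x : ℝ × ℝ × SU2 => F.fld x.1 (x.2.1 / (1 + x.1)) x.2.2) dom := by
  refine F.continuousOn.comp (f := fun x : ℝ × ℝ × SU2 => (x.1, x.2.1 / (1 + x.1), x.2.2)) ?_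
    (fun x hx => ⟨hx.1, div_mem_Ici hx.1 hx.2.1, mem_univ _⟩)
  refine continuousOn_fst.prodMk (ContinuousOn.prodMk ?_ (by fun_prop))
  refine ContinuousOn.div (by fun_prop) (by fun_prop) fun x hx => ?_
  have := hx.1.1
  exact (by linarith : (0 : ℝ) < 1 + x.1).ne'

theorem SF.continuousOn_slab (F : SF) (ρs : ℝ) {τ : ℝ} (hτ : τ ∈ Ioo (-1 : ℝ) 1) :
    ContinuousOn (fun y : ℝ × SU2 => F.fld τ (y.1 / (1 + τ)) y.2) (slab ρs) :=
  F.continuousOn_curve.comp (f := fun y : ℝ × SU2 => (τ, y)) (by fun_prop)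
    (fun _ hy => ⟨hτ, hy.1.1, mem_univ _⟩)

theorem SF.integrableOn_slab (F : SF) (ρs : ℝ) {τ : ℝ} (hτ : τ ∈ Ioo (-1 : ℝ) 1) :
    IntegrableOn (fun y : ℝ × SU2 => F.fld τ (y.1 / (1 + τ)) y.2) (slab ρs)
      (volume.prod haarSU2) :=
  (F.continuousOn_slab ρs hτ).integrableOn_compact' (isCompact_slab ρs) (measurableSet_slab ρs)

theorem avg_smul (ρs τ : ℝ) (c : ℂ) (F : SF) : avg ρs (c • F) τ = c * avg ρs F τ := by
  simp only [avg, SF.fld_smul]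
  exact integral_const_mul _ _

theorem avg_neg (ρs τ : ℝ) (F : SF) : avg ρs (-F) τ = -avg ρs F τ := by
  rw [← neg_one_smul ℂ F, avg_smul, neg_one_mul]

theorem avg_add (ρs : ℝ) {τ : ℝ} (hτ : τ ∈ Ioo (-1 : ℝ) 1) (F G : SF) :
    avg ρs (F + G) τ = avg ρs F τ + avg ρs G τ := by
  simp only [avg, SF.fld_add]
  exact integral_add (F.integrableOn_slab ρs hτ) (G.integrableOn_slab ρs hτ)

theorem avg_coordτ_mul (ρs : ℝ) {τ : ℝ} (hτ : τ ∈ Ioo (-1 : ℝ) 1) (F : SF) :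
    avg ρs (coordτ * F) τ = τ * avg ρs F τ := by
  rw [avg, avg, ← integral_const_mul]
  refine setIntegral_congr_fun (measurableSet_slab ρs) fun y hy => ?_
  simp only [SF.fld_mul]
  rw [coordτ_fld hτ (div_mem_Ici hτ hy.1.1)]

theorem avg_ζ (ρs : ℝ) {τ : ℝ} (hτ : τ ∈ Ioo (-1 : ℝ) 1) (i : Fin 3) (F : SF) :
    avg ρs (ζ i F) τ = 0 := by
  rw [avg, slab, setIntegral_prod _ ((ζ i F).integrableOn_slab ρs hτ), Measure.restrict_univ]
  refine setIntegral_eq_zero_of_forall_eq_zero fun σ hσ => ?_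
  exact integral_ζ i F hτ (div_mem_Ici hτ hσ.1)

theorem avg_xPlus (ρs : ℝ) {τ : ℝ} (hτ : τ ∈ Ioo (-1 : ℝ) 1) (F : SF) :
    avg ρs (xPlus ζ F) τ = 0 := by
  rw [xPlus_apply, avg_add ρs hτ, avg_smul, avg_smul, avg_ζ ρs hτ, avg_ζ ρs hτ]
  simp

theorem avg_xMinus (ρs : ℝ) {τ : ℝ} (hτ : τ ∈ Ioo (-1 : ℝ) 1) (F : SF) :
    avg ρs (xMinus ζ F) τ = 0 := by
  rw [xMinus_apply, avg_add ρs hτ, avg_smul, avg_smul, avg_ζ ρs hτ, avg_ζ ρs hτ]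
  simp

theorem avg_sub (ρs : ℝ) {τ : ℝ} (hτ : τ ∈ Ioo (-1 : ℝ) 1) (F G : SF) :
    avg ρs (F - G) τ = avg ρs F τ - avg ρs G τ := by
  rw [sub_eq_add_neg, avg_add ρs hτ, avg_neg, sub_eq_add_neg]

/-- The derivative of the integrals over the slices. -/
theorem hasDerivAt_avg (ρs : ℝ) {τ : ℝ} (hτ : τ ∈ Ioo (-1 : ℝ) 1) (F : SF) :
    HasDerivAt (avg ρs F) (avg ρs ((1 + coordτ) * δτ F - coordρ * δρ F) τ / (1 + τ)) τ := by
  -- For fixed σ the curve ρ = σ/(1 + τ) is an integral curve of ∂_τ - ρ/(1 + τ) ∂_ρ. The domain of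
  -- integration is then fixed and no boundary term appears.
  have key := hasDerivAt_setIntegral_of_continuousOn (μ := volume.prod haarSU2) (K := slab ρs)
    (I := Ioo (-1) 1) (e := fun τ y => F.fld τ (y.1 / (1 + τ)) y.2)
    (e' := fun τ y => ((1 + coordτ) * δτ F - coordρ * δρ F).fld τ (y.1 / (1 + τ)) y.2 / (1 + τ))
    (isCompact_slab ρs) (measurableSet_slab ρs) isOpen_Ioo
    (fun x hx => F.continuousOn_slab ρs hx) ?_ ?_ hτ
  · rw [integral_div] at key
    exact key
  · have hsub : (Ioo (-1 : ℝ) 1 ×ˢ slab ρs) ⊆ dom := fun z hz => ⟨hz.1, hz.2.1.1, mem_univ _⟩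
    refine (((1 + coordτ) * δτ F - coordρ * δρ F).continuousOn_curve.mono hsub).div
      (by fun_prop) fun z hz => ?_
    have := hz.1.1
    exact_mod_cast (by linarith : (0 : ℝ) < 1 + z.1).ne'
  · intro x hx y hy
    have hρ := div_mem_Ici hx hy.1.1
    have hpos : (0 : ℝ) < 1 + x := by linarith [hx.1]
    have hne : (1 + x : ℂ) ≠ 0 := by exact_mod_cast hpos.ne'
    refine (F.smooth.hasDerivAt_curve hx y.2 hy.1.1).congr_deriv ?_
    rw [SF.fld_sub, SF.fld_mul, SF.fld_mul, SF.fld_add, SF.fld_one hx hρ, coordτ_fld hx hρ,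
      coordρ_fld hx hρ, δτ_fld F hx hρ, δρ_fld F hx hρ]
    push_cast
    field_simp

/-- The flux through the outer boundary. -/
theorem avg_coordρ_mul_δρ_add {τ : ℝ} (hτ : τ ∈ Ioo (-1 : ℝ) 1) {ρs : ℝ} (hρs : 0 ≤ ρs)
    (Q : SF) :
    avg ρs (coordρ * δρ Q + Q) τ = ∫ s, ρs * Q.fld τ (ρs / (1 + τ)) s ∂haarSU2 := by
  have hpos : (0 : ℝ) < 1 + τ := by linarith [hτ.1]
  have hne : (1 + τ : ℂ) ≠ 0 := by exact_mod_cast hpos.ne'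
  set F := coordρ * δρ Q + Q with hF
  have hint := F.integrableOn_slab ρs hτ
  rw [avg, slab, ← Measure.prod_restrict, integral_prod_symm _
    (by rw [Measure.prod_restrict]; exact hint), Measure.restrict_univ]
  congr 1
  funext s
  have hcont : ∀ G : SF, ContinuousOn (fun σ => G.fld τ (σ / (1 + τ)) s) (Icc 0 ρs) := fun G =>
    G.continuousOn_curve.comp (f := fun σ : ℝ => (τ, σ, s)) (by fun_prop)
      (fun _ hy => ⟨hτ, hy.1, mem_univ _⟩)
  rw [integral_Icc_eq_integral_Ioc, ← intervalIntegral.integral_of_le hρs]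
  -- The integrand is the σ-derivative of σ Q(σ/(1 + τ)). The factor σ kills the contribution of ρ =
  -- 0.
  have := intervalIntegral.integral_eq_sub_of_hasDeriv_right_of_le hρs
    (f := fun σ : ℝ => (σ : ℂ) * Q.fld τ (σ / (1 + τ)) s)
    (f' := fun σ : ℝ => F.fld τ (σ / (1 + τ)) s)
    (ContinuousOn.mul (by fun_prop) (hcont Q)) ?_
    ((hcont F).intervalIntegrable_of_Icc hρs)
  · rw [this]
    simp
  · intro σ hσ
    have hρ := div_mem_Ici hτ hσ.1.le
    have h1 : HasDerivAt (fun σ : ℝ => σ / (1 + τ)) (1 / (1 + τ)) σ :=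
      (hasDerivAt_id σ).div_const _
    have h2 : HasDerivAt (fun ρ => Q.fld τ ρ s) (dρ Q.fld τ (σ / (1 + τ)) s) (σ / (1 + τ)) :=
      (Q.smooth.hasDerivWithinAt_ρ hτ hρ s).hasDerivAt (Ici_mem_nhds (div_pos hσ.1 hpos))
    have h3 := ((hasDerivAt_id σ).ofReal_comp).mul (h2.scomp σ h1)
    refine (h3.congr_deriv ?_).hasDerivWithinAt
    rw [hF, SF.fld_add, SF.fld_mul, coordρ_fld hτ hρ, δρ_fld Q hτ hρ]
    simp
    field_simp
    ring

/-- The differential inequality for the energy. -/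
theorem integral_le_of_energy_inequality {G H E' : ℝ → ℝ} {a : ℕ} {b : ℝ} (hb : 1 ≤ b)
    (hG : ∀ τ ∈ Ico (0 : ℝ) 1, 0 ≤ G τ) (hH : ∀ τ ∈ Ico (0 : ℝ) 1, 0 ≤ H τ)
    (hGc : ContinuousOn G (Ioo (-1) 1)) (hHc : ContinuousOn H (Ioo (-1) 1))
    (hE : ∀ τ ∈ Ico (0 : ℝ) 1, HasDerivAt (fun x => G x + (1 - x) / (1 + x) * H x) (E' τ) τ)
    (hle : ∀ τ ∈ Ico (0 : ℝ) 1, E' τ ≤ (2 * a * G τ - 2 * b * H τ) / (1 + τ))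
    {t : ℝ} (ht : t ∈ Ico (0 : ℝ) 1) :
    ∫ x in (0 : ℝ)..t, G x / (1 + x) ≤ 4 ^ a * (G 0 + H 0) ∧
      ∫ x in (0 : ℝ)..t, H x / (1 + x) ≤ 4 ^ a * (G 0 + H 0) := by
  have hsub : ∀ t ∈ Ico (0 : ℝ) 1, Icc 0 t ⊆ Ioo (-1 : ℝ) 1 := fun t ht x hx =>
    ⟨by linarith [hx.1], lt_of_le_of_lt hx.2 ht.2⟩
  have hdivc : ∀ F : ℝ → ℝ, ContinuousOn F (Ioo (-1) 1) →
      ContinuousOn (fun x => F x / (1 + x)) (Ioo (-1) 1) := fun F hF =>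
    hF.div (by fun_prop) fun x hx => (by linarith [hx.1] : (0 : ℝ) < 1 + x).ne'
  set E : ℝ → ℝ := fun x => G x + (1 - x) / (1 + x) * H x with hEdef
  have hE0 : E 0 = G 0 + H 0 := by simp [hEdef]
  have hGE : ∀ x ∈ Ico (0 : ℝ) 1, G x ≤ E x := fun x hx => by
    have h1 : 0 ≤ (1 - x) / (1 + x) := div_nonneg (by linarith [hx.2]) (by linarith [hx.1])
    have := mul_nonneg h1 (hH x hx)
    simp only [hEdef]
    linarith
  have hE0nn : 0 ≤ E 0 := (hG 0 (by simp)).trans (hGE 0 (by simp))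
  have key : ∀ t ∈ Ico (0 : ℝ) 1,
      E t / (1 + t) ^ (2 * a) + (∫ x in (0 : ℝ)..t, H x / (1 + x)) / 4 ^ a ≤ E 0 := by
    intro t ht
    -- The factor (1 + τ)^(-2a) absorbs the growth term 2aG/(1 + τ), and the integral of H is paid
    -- for by the damping. The constant 4^a bounds (1 + τ)^(2a) for τ < 1.
    let Φ : ℝ → ℝ := fun τ => E τ / (1 + τ) ^ (2 * a) + (∫ x in (0 : ℝ)..τ, H x / (1 + x)) / 4 ^ a
    let Φ' : ℝ → ℝ := fun τ => (E' τ * (1 + τ) ^ (2 * a) -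
      E τ * (((2 * a : ℕ) : ℝ) * (1 + τ) ^ (2 * a - 1))) / ((1 + τ) ^ (2 * a)) ^ 2 +
      (H τ / (1 + τ)) / 4 ^ a
    have hΦ : ∀ τ ∈ Ico (0 : ℝ) 1, HasDerivAt Φ (Φ' τ) τ := by
      intro τ hτ
      have hpos : (0 : ℝ) < 1 + τ := by linarith [hτ.1]
      have hmem : τ ∈ Ioo (-1 : ℝ) 1 := ⟨by linarith [hτ.1], hτ.2⟩
      have h1 : HasDerivAt (fun x : ℝ => (1 + x) ^ (2 * a))
          (((2 * a : ℕ) : ℝ) * (1 + τ) ^ (2 * a - 1)) τ := by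
        exact (((hasDerivAt_id τ).const_add 1).pow (2 * a)).congr_deriv (by simp)
      have h2 : HasDerivAt (fun y => ∫ x in (0 : ℝ)..y, H x / (1 + x)) (H τ / (1 + τ)) τ := by
        refine intervalIntegral.integral_hasDerivAt_right ?_ ?_ ?_
        · exact ((hdivc H hHc).mono (hsub τ hτ)).intervalIntegrable_of_Icc hτ.1
        · exact (hdivc H hHc).stronglyMeasurableAtFilter isOpen_Ioo τ hmem
        · exact (hdivc H hHc).continuousAt (isOpen_Ioo.mem_nhds hmem)
      exact ((hE τ hτ).div h1 (by positivity)).add (h2.div_const _)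
    have hΦ'le : ∀ τ ∈ Ico (0 : ℝ) 1, Φ' τ ≤ 0 := by
      intro τ hτ
      have hpos : (0 : ℝ) < 1 + τ := by linarith [hτ.1]
      have hle4 : (1 + τ) ^ (2 * a) ≤ 4 ^ a := by
        rw [pow_mul]
        exact pow_le_pow_left₀ (by positivity) (by nlinarith [hτ.1, hτ.2]) a
      have e1 : (E' τ * (1 + τ) ^ (2 * a) -
          E τ * (((2 * a : ℕ) : ℝ) * (1 + τ) ^ (2 * a - 1))) / ((1 + τ) ^ (2 * a)) ^ 2 =
          (E' τ - 2 * a * E τ / (1 + τ)) / (1 + τ) ^ (2 * a) := by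
        -- For a = 0 the exponent 2a - 1 truncates, but its coefficient vanishes.
        rcases Nat.eq_zero_or_pos a with rfl | ha
        · simp
        · have : (1 + τ) ^ (2 * a) = (1 + τ) ^ (2 * a - 1) * (1 + τ) := by
            rw [← pow_succ]
            congr 1
            omega
          rw [this]
          push_cast
          field_simp
      -- After G ≤ E the bound b ≥ 1 leaves at least one full -H/(1 + τ), with no factor 1 - τ.
      have e2 : E' τ - 2 * a * E τ / (1 + τ) ≤ -(H τ / (1 + τ)) := by
        have h1 := hle τ hτ
        have h2 : (2 * a * G τ - 2 * b * H τ) / (1 + τ) ≤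
            2 * a * E τ / (1 + τ) - H τ / (1 + τ) := by
          rw [← sub_div]
          gcongr
          · exact hGE τ hτ
          · nlinarith [hH τ hτ]
        linarith
      have e3 : (H τ / (1 + τ)) / 4 ^ a ≤ (H τ / (1 + τ)) / (1 + τ) ^ (2 * a) :=
        div_le_div_of_nonneg_left (div_nonneg (hH τ hτ) hpos.le) (by positivity) hle4
      have e4 := div_le_div_of_nonneg_right e2 (by positivity : 0 ≤ (1 + τ) ^ (2 * a))
      show _ + _ ≤ 0
      rw [e1]
      rw [neg_div] at e4
      linarith
    have hanti : AntitoneOn Φ (Icc 0 t) := by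
      have hIco : ∀ x ∈ Icc 0 t, x ∈ Ico (0 : ℝ) 1 := fun x hx => ⟨hx.1, hx.2.trans_lt ht.2⟩
      refine antitoneOn_of_hasDerivWithinAt_nonpos (f' := Φ') (convex_Icc 0 t)
        (fun x hx => (hΦ x (hIco x hx)).continuousAt.continuousWithinAt)
        (fun x hx => (hΦ x (hIco x (interior_subset hx))).hasDerivWithinAt)
        (fun x hx => hΦ'le x (hIco x (interior_subset hx)))
    have := hanti (left_mem_Icc.2 ht.1) (right_mem_Icc.2 ht.1) ht.1
    simpa [Φ] using this
  have hHnn : ∀ t ∈ Ico (0 : ℝ) 1, 0 ≤ ∫ x in (0 : ℝ)..t, H x / (1 + x) := fun t ht =>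
    intervalIntegral.integral_nonneg ht.1 fun x hx => div_nonneg
      (hH x ⟨hx.1, hx.2.trans_lt ht.2⟩) (by linarith [hx.1])
  rw [← hE0]
  constructor
  -- G is bounded at each τ and then integrated over an interval of length at most 1. For H this
  -- would fail, since its weight in E vanishes at τ = 1; there the integral kept in Φ is used.
  · have hGle : ∀ x ∈ Ico (0 : ℝ) 1, G x / (1 + x) ≤ 4 ^ a * E 0 := by
      intro x hx
      have hpos : (0 : ℝ) < 1 + x := by linarith [hx.1]
      have hle4 : (1 + x) ^ (2 * a) ≤ 4 ^ a := by
        rw [pow_mul]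
        exact pow_le_pow_left₀ (by positivity) (by nlinarith [hx.1, hx.2]) a
      have h1 : E x / (1 + x) ^ (2 * a) ≤ E 0 := by
        have := key x hx
        have h2 := div_nonneg (hHnn x hx) (by positivity : (0 : ℝ) ≤ 4 ^ a)
        linarith
      rw [div_le_iff₀ (by positivity)] at h1
      calc G x / (1 + x) ≤ G x := div_le_self (hG x hx) (by linarith [hx.1])
        _ ≤ E 0 * (1 + x) ^ (2 * a) := (hGE x hx).trans h1
        _ ≤ E 0 * 4 ^ a := by gcongr
        _ = 4 ^ a * E 0 := mul_comm _ _
    calc ∫ x in (0 : ℝ)..t, G x / (1 + x) ≤ ∫ _ in (0 : ℝ)..t, 4 ^ a * E 0 :=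
          intervalIntegral.integral_mono_on ht.1
            (((hdivc G hGc).mono (hsub t ht)).intervalIntegrable_of_Icc ht.1)
            intervalIntegrable_const fun x hx => hGle x ⟨hx.1, hx.2.trans_lt ht.2⟩
      _ = t * (4 ^ a * E 0) := by
          rw [intervalIntegral.integral_const, sub_zero, smul_eq_mul]
      _ ≤ 1 * (4 ^ a * E 0) := by
          gcongr
          exact ht.2.le
      _ = _ := one_mul _
  · have h1 := key t ht
    have h2 : 0 ≤ E t / (1 + t) ^ (2 * a) :=
      div_nonneg ((hG t ht).trans (hGE t ht)) (pow_nonneg (by linarith [ht.1]) _)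
    have h3 : (∫ x in (0 : ℝ)..t, H x / (1 + x)) / 4 ^ a ≤ E 0 := by linarith
    rw [div_le_iff₀ (by positivity)] at h3
    linarith

/-! ### The energy estimate for a pair -/

/-- The integral of a word energy over a slice, in the coordinate `(1 + τ) ρ`. -/
def sliceEnergy (ρs : ℝ) (n : ℕ) (F : SF) (τ : ℝ) : ℝ :=
  ∫ y in slab ρs, wordEnergy n F τ (y.1 / (1 + τ)) y.2 ∂(volume.prod haarSU2)

theorem sliceEnergy_nonneg (ρs : ℝ) (n : ℕ) (F : SF) (τ : ℝ) : 0 ≤ sliceEnergy ρs n F τ :=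
  integral_nonneg fun _ => wordEnergy_nonneg _ _ _ _ _

theorem avg_wordDensity (ρs : ℝ) (n : ℕ) (F : SF) {τ : ℝ} (hτ : τ ∈ Ioo (-1 : ℝ) 1) :
    avg ρs (wordDensity n F) τ = sliceEnergy ρs n F τ := by
  rw [avg, sliceEnergy, ← integral_complex_ofReal]
  refine setIntegral_congr_fun (measurableSet_slab ρs) fun y hy => ?_
  exact wordDensity_fld n F hτ (div_mem_Ici hτ hy.1.1) y.2

theorem hasDerivAt_sliceEnergy (ρs : ℝ) (n : ℕ) (F : SF) {τ : ℝ} (hτ : τ ∈ Ioo (-1 : ℝ) 1) :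
    HasDerivAt (sliceEnergy ρs n F)
      ((avg ρs ((1 + coordτ) * δτ (wordDensity n F) - coordρ * δρ (wordDensity n F)) τ).re
        / (1 + τ)) τ := by
  have h := Complex.reCLM.hasFDerivAt.comp_hasDerivAt τ
    (hasDerivAt_avg ρs hτ (wordDensity n F))
  refine (h.congr_of_eventuallyEq ?_).congr_deriv ?_
  · filter_upwards [isOpen_Ioo.mem_nhds hτ] with x hx
    simp [avg_wordDensity ρs n F hx]
  · rw [show (1 + τ : ℂ) = ((1 + τ : ℝ) : ℂ) by push_cast; rfl]
    exact Complex.div_ofReal_re _ _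

theorem continuousOn_sliceEnergy (ρs : ℝ) (n : ℕ) (F : SF) :
    ContinuousOn (sliceEnergy ρs n F) (Ioo (-1) 1) := fun _ hτ =>
  (hasDerivAt_sliceEnergy ρs n F hτ).continuousAt.continuousWithinAt

/-- By the boundary formula the quantity is ρ_* times the integral of a sum of squares over the
outer sphere: `h` only leaves through this boundary. -/
theorem flux_nonneg {ρs : ℝ} (hρs : 0 ≤ ρs) (n : ℕ) (F : SF) {τ : ℝ} (hτ : τ ∈ Ioo (-1 : ℝ) 1) :
    0 ≤ (avg ρs (coordρ * δρ (wordDensity n F) + wordDensity n F) τ).re := by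
  rw [avg_coordρ_mul_δρ_add hτ hρs]
  have : (fun s => (ρs : ℂ) * (wordDensity n F).fld τ (ρs / (1 + τ)) s) =
      fun s => ((ρs * wordEnergy n F τ (ρs / (1 + τ)) s : ℝ) : ℂ) := by
    funext s
    rw [wordDensity_fld n F hτ (div_mem_Ici hτ hρs)]
    push_cast [wordEnergy]
    rfl
  rw [this, integral_complex_ofReal]
  exact integral_nonneg fun s => mul_nonneg hρs (wordEnergy_nonneg _ _ _ _ _)

/-- The energy estimate for a pair of consecutive components. -/
theorem IsSpinPair.integral_sliceEnergy_le {a : ℕ} {b : ℝ} (hb : 1 ≤ b) {g h : SF}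
    (H : IsSpinPair (-a) b g h) {ρs : ℝ} (hρs : 0 ≤ ρs) (n : ℕ) {t : ℝ}
    (ht : t ∈ Ico (0 : ℝ) 1) :
    ∫ x in (0 : ℝ)..t, sliceEnergy ρs n g x / (1 + x) ≤
        4 ^ a * (sliceEnergy ρs n g 0 + sliceEnergy ρs n h 0) ∧
      ∫ x in (0 : ℝ)..t, sliceEnergy ρs n h x / (1 + x) ≤
        4 ^ a * (sliceEnergy ρs n g 0 + sliceEnergy ρs n h 0) := by
  set P := wordDensity n g with hP
  set Q := wordDensity n h with hQ
  have hIoo : ∀ τ ∈ Ico (0 : ℝ) 1, τ ∈ Ioo (-1 : ℝ) 1 := fun τ hτ => ⟨by linarith [hτ.1], hτ.2⟩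
  refine integral_le_of_energy_inequality (b := b) (E' := fun τ =>
      (avg ρs ((1 + coordτ) * δτ P - coordρ * δρ P) τ).re / (1 + τ) +
      (-2 / (1 + τ) ^ 2 * sliceEnergy ρs n h τ + (1 - τ) / (1 + τ) *
        ((avg ρs ((1 + coordτ) * δτ Q - coordρ * δρ Q) τ).re / (1 + τ)))) hb
    (fun τ _ => sliceEnergy_nonneg _ _ _ _) (fun τ _ => sliceEnergy_nonneg _ _ _ _)
    (continuousOn_sliceEnergy _ _ _) (continuousOn_sliceEnergy _ _ _) ?_ ?_ ht
  · intro τ hτ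
    have hpos : (0 : ℝ) < 1 + τ := by linarith [hτ.1]
    have h1 : HasDerivAt (fun x : ℝ => (1 - x) / (1 + x)) (-2 / (1 + τ) ^ 2) τ := by
      refine (((hasDerivAt_id τ).const_sub 1).div ((hasDerivAt_id τ).const_add 1)
        hpos.ne').congr_deriv ?_
      simp only [id]
      congr 1
      ring
    exact (hasDerivAt_sliceEnergy ρs n g (hIoo τ hτ)).add
      (h1.mul (hasDerivAt_sliceEnergy ρs n h (hIoo τ hτ)))
  · intro τ hτ
    have hτ' := hIoo τ hτ
    have hpos : (0 : ℝ) < 1 + τ := by linarith [hτ.1]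
    have id1 : (avg ρs ((1 + coordτ) * δτ P - coordρ * δρ P
        + ((1 - coordτ) * δτ Q + coordρ * δρ Q)) τ).re =
        (avg ρs (-((2 * ((-(a : ℝ) : ℝ) : ℂ)) • P) - (2 * (b : ℂ)) • Q
          - xMinus ζ (wordForm ζ n (Spin2.conj h) g)
          - xPlus ζ (wordForm ζ n (Spin2.conj g) h)) τ).re :=
      congrArg (fun F => (avg ρs F τ).re) (IsPair.energy isCoordSystem H H.conj n)
    -- The transport of `h` is rewritten through the operator that differentiates along fixed σ. The
    -- remainder -2ρ∂_ρ is one half of the flux term.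
    have id2 : ((1 : SF) - coordτ) * ((1 + coordτ) * δτ Q - coordρ * δρ Q) =
        (1 + coordτ) * ((1 - coordτ) * δτ Q + coordρ * δρ Q) - (2 : ℂ) • (coordρ * δρ Q) := by
      rw [two_smul]
      ring
    have id3 : (avg ρs _ τ).re = (avg ρs _ τ).re := congrArg (fun F => (avg ρs F τ).re) id2
    have hfl := flux_nonneg hρs n h hτ'
    have hPa := avg_wordDensity ρs n g hτ'
    have hQa := avg_wordDensity ρs n h hτ'
    rw [← hP] at hPa
    rw [← hQ] at hQa hfl
    have e1 : ∀ F : SF, avg ρs ((1 + coordτ) * F) τ = ((1 + τ : ℝ) : ℂ) * avg ρs F τ := by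
      intro F
      rw [add_mul, one_mul, avg_add ρs hτ', avg_coordτ_mul ρs hτ']
      push_cast
      ring
    have e2 : ∀ F : SF, avg ρs ((1 - coordτ) * F) τ = ((1 - τ : ℝ) : ℂ) * avg ρs F τ := by
      intro F
      rw [sub_mul, one_mul, avg_sub ρs hτ', avg_coordτ_mul ρs hτ']
      push_cast
      ring
    have e3 : ((2 * ((-(a : ℝ) : ℝ) : ℂ)) : ℂ) = ((-(2 * a) : ℝ) : ℂ) := by push_cast; ring
    have e4 : ((2 * (b : ℂ)) : ℂ) = ((2 * b : ℝ) : ℂ) := by push_cast; ring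
    have e5 : (2 : ℂ) = ((2 : ℝ) : ℂ) := by norm_num
    rw [e3, e4, avg_add ρs hτ', avg_sub ρs hτ' _ (xPlus ζ _), avg_sub ρs hτ' _ (xMinus ζ _),
      avg_xPlus ρs hτ', avg_xMinus ρs hτ', avg_sub ρs hτ' (-_), avg_neg, avg_smul, avg_smul,
      hPa, hQa, sub_zero, sub_zero, Complex.sub_re, Complex.neg_re, Complex.re_ofReal_mul,
      Complex.re_ofReal_mul, Complex.ofReal_re, Complex.ofReal_re, Complex.add_re] at id1
    rw [e2, avg_sub ρs hτ' ((1 + coordτ) * (_ + _)), e1, avg_smul, e5, Complex.re_ofReal_mul,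
      Complex.sub_re, Complex.re_ofReal_mul, Complex.re_ofReal_mul] at id3
    rw [avg_add ρs hτ', hQa, Complex.add_re, Complex.ofReal_re] at hfl
    set A := (avg ρs ((1 + coordτ) * δτ P - coordρ * δρ P) τ).re
    set B := (avg ρs ((1 + coordτ) * δτ Q - coordρ * δρ Q) τ).re
    set M := (avg ρs ((1 - coordτ) * δτ Q + coordρ * δρ Q) τ).re
    set R := (avg ρs (coordρ * δρ Q) τ).re
    set G := sliceEnergy ρs n g τ
    set K := sliceEnergy ρs n h τ
    -- The derivative -2/(1 + τ)² of the weight supplies the `K` that completes `R` to the boundary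
    -- flux `R + K`. This enters with a negative sign and is dropped.
    have e6 : A / (1 + τ) + (-2 / (1 + τ) ^ 2 * K + (1 - τ) / (1 + τ) * (B / (1 + τ))) =
        (2 * a * G - 2 * b * K) / (1 + τ) - 2 / (1 + τ) ^ 2 * (R + K) := by
      have hB : (1 - τ) / (1 + τ) * (B / (1 + τ)) = ((1 - τ) * B) / (1 + τ) ^ 2 := by
        field_simp
      have hA : A = 2 * a * G - 2 * b * K - M := by linarith
      rw [hB, id3, hA]
      field_simp
      ring
    show A / (1 + τ) + (-2 / (1 + τ) ^ 2 * K + (1 - τ) / (1 + τ) * (B / (1 + τ))) ≤ _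
    rw [e6]
    have := mul_nonneg (by positivity : 0 ≤ 2 / (1 + τ) ^ 2) hfl
    linarith

/-! ### Integrability and integration over N_t by slices -/

theorem continuousOn_wordEnergy (n : ℕ) (F : SF) :
    ContinuousOn (fun x : ℝ × ℝ × SU2 => wordEnergy n F x.1 x.2.1 x.2.2) dom :=
  continuousOn_finsetSum _ fun _ _ => ((SF.continuousOn _).norm.pow 2)

theorem continuousOn_density {f : Fld} {F : SF} (h : Agree f F) (c : ℝ) (m : ℕ) :
    ContinuousOn (fun x : ℝ × ℝ × SU2 => density c m f x.1 x.2.1 x.2.2) dom := by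
  refine ContinuousOn.congr (f := fun x : ℝ × ℝ × SU2 => c ^ 2 * ∑ y ∈ indices m,
      weight y.2.2 ^ 2 * ‖(symEnd ζ y.2.2 (mixed y.1 y.2.1 F)).fld x.1 x.2.1 x.2.2‖ ^ 2) ?_
    fun x hx => density_eq h c m hx.1 hx.2.1 x.2.2
  exact continuousOn_const.mul (continuousOn_finsetSum _ fun _ _ =>
    continuousOn_const.mul ((SF.continuousOn _).norm.pow 2))

theorem N_subset_dom (ρs : ℝ) {t : ℝ} (ht : t ∈ Ico (0 : ℝ) 1) : N ρs t ⊆ dom := fun x hx =>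
  ⟨⟨by linarith [hx.1], hx.2.1.trans_lt ht.2⟩, hx.2.2.1, mem_univ _⟩

theorem isCompact_N (ρs t : ℝ) : IsCompact (N ρs t) := by
  -- Clearing the denominator 1 + τ exhibits the set as a closed subset of a compact box.
  have h1 : N ρs t = (Icc 0 t ×ˢ Icc 0 ρs ×ˢ univ) ∩ {x | x.2.1 * (1 + x.1) ≤ ρs} := by
    ext x
    simp only [N, mem_ofPred_eq, mem_inter_iff, mem_prod, mem_Icc, mem_univ, and_true]
    constructor
    · rintro ⟨h0, ht, h2, h3⟩
      have hpos : 0 < 1 + x.1 := by linarith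
      rw [le_div_iff₀ hpos] at h3
      exact ⟨⟨⟨h0, ht⟩, h2, by nlinarith⟩, h3⟩
    · rintro ⟨⟨⟨h0, ht⟩, h2, _⟩, h3⟩
      have hpos : 0 < 1 + x.1 := by linarith
      exact ⟨h0, ht, h2, (le_div_iff₀ hpos).2 h3⟩
  rw [h1]
  exact (isCompact_Icc.prod (isCompact_Icc.prod isCompact_univ)).inter_right
    (isClosed_le (by fun_prop) continuous_const)

theorem S_eq_prod (ρs t : ℝ) : S ρs t = Icc 0 (ρs / (1 + t)) ×ˢ univ := by
  ext y
  simp [S]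

theorem S_zero (ρs : ℝ) : S ρs 0 = slab ρs := by
  rw [S_eq_prod, slab, add_zero, div_one]

theorem integrableOn_N {ρs t : ℝ} (ht : t ∈ Ico (0 : ℝ) 1)
    {f : ℝ × ℝ × SU2 → ℝ} (hf : ContinuousOn f dom) :
    IntegrableOn f (N ρs t) (volume.prod (volume.prod haarSU2)) :=
  (hf.mono (N_subset_dom ρs ht)).integrableOn_compact' (isCompact_N ρs t)
    (isCompact_N ρs t).isClosed.measurableSet

theorem integrableOn_slice {A τ : ℝ} (hτ : τ ∈ Ioo (-1 : ℝ) 1)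
    {f : ℝ × ℝ × SU2 → ℝ} (hf : ContinuousOn f dom) :
    IntegrableOn (fun y : ℝ × SU2 => f (τ, y)) (Icc 0 A ×ˢ univ) (volume.prod haarSU2) := by
  refine ContinuousOn.integrableOn_compact' (isCompact_Icc.prod isCompact_univ)
    (measurableSet_Icc.prod MeasurableSet.univ) ?_
  exact hf.comp (f := fun y : ℝ × SU2 => (τ, y)) (by fun_prop)
    (fun y hy => ⟨hτ, hy.1.1, mem_univ _⟩)

/-- Integration over a slice in the coordinate `(1 + τ) ρ`. -/
theorem integral_slice_eq {ρs τ : ℝ} (hρs : 0 < ρs) (hτ : τ ∈ Ioo (-1 : ℝ) 1)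
    {f : ℝ × ℝ × SU2 → ℝ} (hf : ContinuousOn f dom) :
    ∫ y in S ρs τ, f (τ, y) ∂(volume.prod haarSU2) =
      (∫ y in slab ρs, f (τ, y.1 / (1 + τ), y.2) ∂(volume.prod haarSU2)) / (1 + τ) := by
  have hpos : (0 : ℝ) < 1 + τ := by linarith [hτ.1]
  have hc : ContinuousOn (fun y : ℝ × SU2 => f (τ, y.1 / (1 + τ), y.2)) (slab ρs) :=
    hf.comp (f := fun y : ℝ × SU2 => (τ, y.1 / (1 + τ), y.2)) (by fun_prop)
      (fun y hy => ⟨hτ, div_mem_Ici hτ hy.1.1, mem_univ _⟩)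
  have hi : IntegrableOn (fun y : ℝ × SU2 => f (τ, y.1 / (1 + τ), y.2)) (slab ρs)
      (volume.prod haarSU2) :=
    hc.integrableOn_compact' (isCompact_slab ρs) (measurableSet_slab ρs)
  rw [S_eq_prod, setIntegral_prod _ (integrableOn_slice hτ hf), slab, setIntegral_prod _ hi,
    integral_Icc_eq_integral_Ioc, integral_Icc_eq_integral_Ioc,
    ← intervalIntegral.integral_of_le (div_nonneg hρs.le hpos.le),
    ← intervalIntegral.integral_of_le hρs.le,
    intervalIntegral.integral_comp_div
      (fun ρ => ∫ s in univ, f (τ, ρ, s) ∂haarSU2) hpos.ne', zero_div, smul_eq_mul,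
    mul_div_cancel_left₀ _ hpos.ne']

/-- Integration over `N_t` by slices. -/
theorem integral_N_eq {ρs t : ℝ} (hρs : 0 < ρs) (ht : t ∈ Ico (0 : ℝ) 1)
    {f : ℝ × ℝ × SU2 → ℝ} (hf : ContinuousOn f dom) :
    ∫ x in N ρs t, f x ∂(volume.prod (volume.prod haarSU2)) =
      ∫ τ in (0 : ℝ)..t,
        (∫ y in slab ρs, f (τ, y.1 / (1 + τ), y.2) ∂(volume.prod haarSU2)) / (1 + τ) := by
  have hm : MeasurableSet (N ρs t) := (isCompact_N ρs t).isClosed.measurableSet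
  have hSm : ∀ τ, MeasurableSet (S ρs τ) := fun τ => by
    rw [S_eq_prod]
    exact measurableSet_Icc.prod MeasurableSet.univ
  rw [← integral_indicator hm, integral_prod _ ((integrableOn_N ht hf).integrable_indicator hm),
    intervalIntegral.integral_of_le ht.1, ← integral_Icc_eq_integral_Ioc,
    ← integral_indicator measurableSet_Icc]
  congr 1
  funext τ
  by_cases hτ : τ ∈ Icc 0 t
  · have hτ' : τ ∈ Ioo (-1 : ℝ) 1 := ⟨by linarith [hτ.1], hτ.2.trans_lt ht.2⟩
    rw [indicator_of_mem hτ, ← integral_slice_eq hρs hτ' hf, ← integral_indicator (hSm τ)]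
    congr 1
    funext y
    by_cases hy : y ∈ S ρs τ
    · rw [indicator_of_mem hy, indicator_of_mem]
      exact ⟨hτ.1, hτ.2, hy.1, hy.2⟩
    · rw [indicator_of_notMem hy, indicator_of_notMem]
      exact fun h => hy ⟨h.2.2.1, h.2.2.2⟩
  · rw [indicator_of_notMem hτ]
    have : ∀ y : ℝ × SU2, (N ρs t).indicator f (τ, y) = 0 := fun y =>
      indicator_of_notMem (fun h => hτ ⟨h.1, h.2.1⟩) _
    simp [this]

theorem integral_N_wordEnergy {ρs t : ℝ} (hρs : 0 < ρs) (ht : t ∈ Ico (0 : ℝ) 1) (n : ℕ)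
    (F : SF) :
    ∫ x in N ρs t, wordEnergy n F x.1 x.2.1 x.2.2 ∂(volume.prod (volume.prod haarSU2)) =
      ∫ τ in (0 : ℝ)..t, sliceEnergy ρs n F τ / (1 + τ) :=
  integral_N_eq hρs ht (continuousOn_wordEnergy n F)

/-- The energy estimate for the derivatives of a component of a solution. -/
theorem IsSpin2Solution.integral_wordEnergy_le {φ : Fin 5 → Fld} (hφ : IsSpin2Solution φ)
    {m p : ℕ} (hp : m + 2 < p) {ρs : ℝ} (hρs : 0 < ρs) {q r : ℕ} (hqr : q + r ≤ m) (n : ℕ)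
    {t : ℝ} (ht : t ∈ Ico (0 : ℝ) 1) (k : Fin 5) :
    ∫ x in N ρs t, wordEnergy n (mixed q r (δρ^[p] (toSF (φ k) (hφ.smooth k)))) x.1 x.2.1 x.2.2
        ∂(volume.prod (volume.prod haarSU2)) ≤
      2 * 4 ^ (p + m + 1) *
        ∑ j, sliceEnergy ρs n (mixed q r (δρ^[p] (toSF (φ j) (hφ.smooth j)))) 0 := by
  set G : Fin 5 → SF := fun j => mixed q r (δρ^[p] (toSF (φ j) (hφ.smooth j))) with hG
  have hsingle : ∀ j, sliceEnergy ρs n (G j) 0 ≤ ∑ j, sliceEnergy ρs n (G j) 0 := fun j =>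
    Finset.single_le_sum (f := fun j => sliceEnergy ρs n (G j) 0)
      (fun j _ => sliceEnergy_nonneg _ _ _ _) (Finset.mem_univ j)
  have hpair : ∀ i : Fin 4,
      ∫ x in (0 : ℝ)..t, sliceEnergy ρs n (G i.castSucc) x / (1 + x) ≤
        2 * 4 ^ (p + m + 1) * ∑ j, sliceEnergy ρs n (G j) 0 ∧
      ∫ x in (0 : ℝ)..t, sliceEnergy ρs n (G i.succ) x / (1 + x) ≤
        2 * 4 ^ (p + m + 1) * ∑ j, sliceEnergy ρs n (G j) 0 := by
    intro i
    have hi : (i : ℕ) ≤ 3 := by omega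
    have H := (hφ.isSpinPair i).mixed q (r + p)
    rw [← mixed_iterate, ← mixed_iterate] at H
    -- The truncated subtraction is a true one, since q + 2 ≤ m + 2 < p.
    have ha : (2 - (i : ℕ) + q - (r + p : ℕ) : ℝ) = -((r + p + i - (q + 2) : ℕ) : ℝ) := by
      rw [Nat.cast_sub (by omega)]
      push_cast
      ring
    -- This is where p > m + 2 is decisive: i ≤ 3 and q ≤ m give i + q ≤ m + 3 ≤ p, with equality in
    -- the worst case i = 3, q = m, p = m + 3.
    have hb : (1 : ℝ) ≤ 1 - (i : ℕ) - q + (r + p : ℕ) := by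
      have : ((i + q : ℕ) : ℝ) ≤ ((r + p : ℕ) : ℝ) := by exact_mod_cast (by omega)
      push_cast at this ⊢
      linarith
    rw [ha] at H
    have key := IsSpinPair.integral_sliceEnergy_le hb H hρs.le n ht
    have hle : (4 : ℝ) ^ (r + p + i - (q + 2)) *
        (sliceEnergy ρs n (G i.castSucc) 0 + sliceEnergy ρs n (G i.succ) 0) ≤
        2 * 4 ^ (p + m + 1) * ∑ j, sliceEnergy ρs n (G j) 0 := by
      -- With r ≤ m and i ≤ 3 the exponent is at most m + p + 3 - 2. The factor 2 of the final
      -- constant comes from bounding each of the two components of the pair by the full sum.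
      have h1 : (4 : ℝ) ^ (r + p + i - (q + 2)) ≤ 4 ^ (p + m + 1) :=
        pow_le_pow_right₀ (by norm_num) (by omega)
      have h2 := add_le_add (hsingle i.castSucc) (hsingle i.succ)
      calc _ ≤ 4 ^ (p + m + 1) *
            (∑ j, sliceEnergy ρs n (G j) 0 + ∑ j, sliceEnergy ρs n (G j) 0) :=
            mul_le_mul h1 h2 (add_nonneg (sliceEnergy_nonneg _ _ _ _)
              (sliceEnergy_nonneg _ _ _ _)) (by positivity)
        _ = _ := by ring
    exact ⟨key.1.trans hle, key.2.trans hle⟩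
  rw [integral_N_wordEnergy hρs ht]
  -- φ_4 occurs only as the second member of the last pair; every other component is the first
  -- member of a pair.
  refine Fin.lastCases ?_ (fun i => ?_) k
  · exact (hpair 3).2
  · exact (hpair i).1

theorem sliceEnergy_zero (ρs : ℝ) (n : ℕ) (F : SF) :
    sliceEnergy ρs n F 0 = ∫ y in slab ρs, wordEnergy n F 0 y.1 y.2 ∂(volume.prod haarSU2) := by
  simp [sliceEnergy]

end Spin2

end

/-! ### The uniform estimate for the density -/

open Spin2

theorem mainTheorem2 (m p : ℕ) (hp : m + 2 < p) :
    ∃ C : ℝ, 0 < C ∧ ∀ (c : ℝ), 0 < c → ∀ (ρs : ℝ), 0 < ρs →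
      ∀ φ : Fin 5 → Spin2.Fld, Spin2.IsSpin2Solution φ →
        (∀ k : Fin 5, IntegrableOn
          (fun y : ℝ × Spin2.SU2 => Spin2.density c m (Spin2.dρ^[p] (φ k)) 0 y.1 y.2)
          (Spin2.S ρs 0) (volume.prod Spin2.haarSU2)) ∧
        (∀ t ∈ Ico (0 : ℝ) 1, ∀ k : Fin 5,
          IntegrableOn
            (fun x : ℝ × ℝ × Spin2.SU2 =>
              Spin2.density c m (Spin2.dρ^[p] (φ k)) x.1 x.2.1 x.2.2)
            (Spin2.N ρs t) (volume.prod (volume.prod Spin2.haarSU2)) ∧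
          ∫ x in Spin2.N ρs t, Spin2.density c m (Spin2.dρ^[p] (φ k)) x.1 x.2.1 x.2.2
              ∂(volume.prod (volume.prod Spin2.haarSU2)) ≤
            C * ∑ j : Fin 5, ∫ y in Spin2.S ρs 0,
              Spin2.density c m (Spin2.dρ^[p] (φ j)) 0 y.1 y.2
                ∂(volume.prod Spin2.haarSU2)) ∧
        (∀ k : Fin 5, BddAbove ((fun t : ℝ =>
          ∫ x in Spin2.N ρs t, Spin2.density c m (Spin2.dρ^[p] (φ k)) x.1 x.2.1 x.2.2
            ∂(volume.prod (volume.prod Spin2.haarSU2))) '' Ico (0 : ℝ) 1)) := by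
  obtain ⟨K, hK, hKle⟩ := exists_wordEnergy_le_density m
  let B : ℝ := ∑ x ∈ indices m, (weight x.2.2 ^ 2 * (words x.2.2).card) *
    (2 * 4 ^ (p + m + 1) * K)
  have hB : 0 ≤ B := Finset.sum_nonneg fun x _ => by positivity
  -- The summand 1 only makes the constant positive. The factor c² enters both sides equally, so the
  -- constant is independent of c.
  refine ⟨B + 1, by linarith, fun c hc ρs hρs φ hφ => ?_⟩
  let F : Fin 5 → SF := fun k => δρ^[p] (toSF (φ k) (hφ.smooth k))
  have hF : ∀ k, Agree (dρ^[p] (φ k)) (F k) := fun k =>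
    (agree_toSF (hφ.smooth k)).dρ_iterate p
  have h0 : (0 : ℝ) ∈ Ioo (-1 : ℝ) 1 := by norm_num
  have hS : ∀ k, IntegrableOn (fun y : ℝ × SU2 => density c m (dρ^[p] (φ k)) 0 y.1 y.2)
      (S ρs 0) (volume.prod haarSU2) := fun k => by
    rw [S_zero]
    exact integrableOn_slice h0 (continuousOn_density (hF k) c m)
  have hdens : ∀ (k : Fin 5) τ ρ s, 0 ≤ density c m (dρ^[p] (φ k)) τ ρ s := fun k τ ρ s =>
    Finset.sum_nonneg fun _ _ => sq_nonneg _
  have hI0 : 0 ≤ ∑ j : Fin 5, ∫ y in S ρs 0, density c m (dρ^[p] (φ j)) 0 y.1 y.2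
      ∂(volume.prod haarSU2) :=
    Finset.sum_nonneg fun j _ => integral_nonneg fun y => hdens j 0 y.1 y.2
  have hmain : ∀ t ∈ Ico (0 : ℝ) 1, ∀ k : Fin 5,
      ∫ x in N ρs t, density c m (dρ^[p] (φ k)) x.1 x.2.1 x.2.2
        ∂(volume.prod (volume.prod haarSU2)) ≤
      (B + 1) * ∑ j : Fin 5, ∫ y in S ρs 0, density c m (dρ^[p] (φ j)) 0 y.1 y.2
        ∂(volume.prod haarSU2) := by
    intro t ht k
    have hint : ∀ x ∈ indices m, IntegrableOn (fun z : ℝ × ℝ × SU2 =>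
        (weight x.2.2 ^ 2 * (words x.2.2).card) * (c ^ 2 *
          wordEnergy (∑ i, x.2.2 i) (mixed x.1 x.2.1 (F k)) z.1 z.2.1 z.2.2))
        (N ρs t) (volume.prod (volume.prod haarSU2)) := fun x _ =>
      integrableOn_N ht (continuousOn_const.mul
        (continuousOn_const.mul (continuousOn_wordEnergy _ _)))
    have step1 : ∫ x in N ρs t, density c m (dρ^[p] (φ k)) x.1 x.2.1 x.2.2
        ∂(volume.prod (volume.prod haarSU2)) ≤
        ∑ x ∈ indices m, (weight x.2.2 ^ 2 * (words x.2.2).card) * (c ^ 2 *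
          ∫ z in N ρs t, wordEnergy (∑ i, x.2.2 i) (mixed x.1 x.2.1 (F k)) z.1 z.2.1 z.2.2
            ∂(volume.prod (volume.prod haarSU2))) := by
      refine (setIntegral_mono_on (integrableOn_N ht (continuousOn_density (hF k) c m))
        (integrable_finsetSum _ hint) (isCompact_N ρs t).isClosed.measurableSet
        fun z hz => density_le (hF k) c m (N_subset_dom ρs ht hz).1
          (N_subset_dom ρs ht hz).2.1 z.2.2).trans_eq ?_
      rw [integral_finsetSum _ hint]
      refine Finset.sum_congr rfl fun x _ => ?_
      rw [integral_const_mul, integral_const_mul]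
    -- Each word energy is propagated separately, and only its initial value is converted back to
    -- the density. Thus the comparison between words and symmetrized operators is used once at
    -- either end.
    have step2 : ∀ x ∈ indices m, c ^ 2 *
        ∫ z in N ρs t, wordEnergy (∑ i, x.2.2 i) (mixed x.1 x.2.1 (F k)) z.1 z.2.1 z.2.2
          ∂(volume.prod (volume.prod haarSU2)) ≤
        2 * 4 ^ (p + m + 1) * K * ∑ j : Fin 5, ∫ y in S ρs 0,
          density c m (dρ^[p] (φ j)) 0 y.1 y.2 ∂(volume.prod haarSU2) := by
      rintro ⟨q, r, α⟩ hx
      rw [mem_indices] at hx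
      have h1 := hφ.integral_wordEnergy_le hp hρs (q := q) (r := r) (by omega) (∑ i, α i) ht k
      have h2 : ∀ j, c ^ 2 * sliceEnergy ρs (∑ i, α i) (mixed q r (F j)) 0 ≤
          K * ∫ y in S ρs 0, density c m (dρ^[p] (φ j)) 0 y.1 y.2 ∂(volume.prod haarSU2) := by
        intro j
        rw [sliceEnergy_zero, ← integral_const_mul, ← integral_const_mul, S_zero]
        refine setIntegral_mono_on
          ((integrableOn_slice h0 (continuousOn_wordEnergy _ _)).const_mul _)
          ((integrableOn_slice h0 (continuousOn_density (hF j) c m)).const_mul _)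
          (measurableSet_slab ρs) fun y hy => ?_
        exact hKle c _ _ (hF j) q r _ hx 0 h0 y.1 hy.1.1 y.2
      calc _ ≤ c ^ 2 * (2 * 4 ^ (p + m + 1) *
            ∑ j, sliceEnergy ρs (∑ i, α i) (mixed q r (F j)) 0) :=
            mul_le_mul_of_nonneg_left h1 (sq_nonneg c)
        _ = 2 * 4 ^ (p + m + 1) *
            ∑ j, c ^ 2 * sliceEnergy ρs (∑ i, α i) (mixed q r (F j)) 0 := by
            rw [← Finset.mul_sum]
            ring
        _ ≤ 2 * 4 ^ (p + m + 1) * ∑ j : Fin 5, K * ∫ y in S ρs 0,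
            density c m (dρ^[p] (φ j)) 0 y.1 y.2 ∂(volume.prod haarSU2) := by
            refine mul_le_mul_of_nonneg_left (Finset.sum_le_sum fun j _ => h2 j) (by positivity)
        _ = _ := by
            rw [← Finset.mul_sum]
            ring
    calc _ ≤ _ := step1
      _ ≤ ∑ x ∈ indices m, (weight x.2.2 ^ 2 * (words x.2.2).card) *
          (2 * 4 ^ (p + m + 1) * K * ∑ j : Fin 5, ∫ y in S ρs 0,
            density c m (dρ^[p] (φ j)) 0 y.1 y.2 ∂(volume.prod haarSU2)) :=
          Finset.sum_le_sum fun x hx => mul_le_mul_of_nonneg_left (step2 x hx) (by positivity)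
      _ = B * ∑ j : Fin 5, ∫ y in S ρs 0,
            density c m (dρ^[p] (φ j)) 0 y.1 y.2 ∂(volume.prod haarSU2) := by
          simp only [B, Finset.sum_mul, mul_assoc]
      _ ≤ _ := by
          gcongr
          linarith
  exact ⟨hS, fun t ht k => ⟨integrableOn_N ht (continuousOn_density (hF k) c m), hmain t ht k⟩,
    fun k => bddAbove_def.2 ⟨_, forall_mem_image.2 fun t ht => hmain t ht k⟩⟩
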